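/- Let $[n]=\{1,\dots,n\}$. The *arcs* of a partition $P$ of $[n]$ are the pairs $(i,j)$, $i<j$, of consecutive elements of a block of $P$; they determine $P$. Two arcs $(i_1,j_1),(i_2,j_2)$ form a *2-crossing* if $i_1<i_2<j_1<j_2$, and $\mathrm{Cr}_2(P)$ is the number of 2-crossings of $P$. For $S,T\subseteq[n]$ with $|S|=|T|$ let $P_n(S,T)$ be the set of partitions of $[n]$ whose set of minimal block elements is $S$ and whose set of maximal block elements is $T$. *The statistic $\mathrm{pmaj}$.* Label the arcs of $P$ by $1,2,\dots,k$ in decreasing order of left-hand endpoints, and let $r_1>\dots>r_k$ be the right-hand endpoints. Put $\sigma(r_1)=(a)$, where $a$ is the label of the arc ending at $r_1$; obtain $\sigma(r_{t+1})$ from $\sigma(r_t)$ by deleting the labels of all arcs whose left-hand endpoint $l$ satisfies $r_{t+1}\le l<r_t$ and then writing in front the label of the arc ending at $r_{t+1}$. Then $\mathrm{pmaj}(P)=\sum_t \mathrm{des}(\sigma(r_t))$, where $\mathrm{des}$ counts descents. *The map $\varphi$ on matchings.* A matching is a finite set of arcs $(i,j)$, $i<j$, on linearly ordered vertices, every vertex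 belonging to exactly one arc. Put $\varphi(\emptyset)=\emptyset$. For a nonempty matching $M$ with last vertex $v$ and arc $(i,v)$ let $N=\varphi(M\setminus\{(i,v)\})$. An arc $(a,b)\ne(i,v)$ is *large* if $a<i$ and *small* if $a>i$. Let $\mathcal R$ be the set of right-hand endpoints $j>i$ of $N$; let $e_L$ be the large arc of $N$ with the biggest right-hand endpoint $e_L^r$ in $\mathcal R$, and $e_S=(e_S^l,e_S^r)$ the small arc of $N$ with the smallest left-hand endpoint that crosses $e_L$. If both exist, put $\mathcal R_1=\{j\in\mathcal R:e_S^l<j\le e_S^r\}$ and $\mathcal R_2=\{j\in\mathcal R:j<e_S^l\}$; if only $e_L$ exists, $\mathcal R_1=\emptyset$ and $\mathcal R_2=\{j\in\mathcal R: j\le e_L^r\}$; if $e_L$ does not exist, $\mathcal R_1=\mathcal R_2=\emptyset$. Change $N$ as follows, $(i_s,j_s)$ always denoting the current arc ending at $j_s$. (I) If $\mathcal R_1\neq\emptyset$, start with $j_1=e_S^r$ and let $j_2$ run through the other elements of $\mathcal R_1$ from right to left. If $(i_2,j_2)$ is large, replace $(i_1,j_1),(i_2,j_2)$ by $(i_1,j_2),(i_2,j_1)$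 and set $j_1:=j_2$. If $(i_2,j_2)$ is small and there is no right-hand endpoint between $i_1$ and $i_2$, only set $j_1:=j_2$. If it is small, there is such a right-hand endpoint and $i_1<i_2$, do nothing. If it is small, there is such a right-hand endpoint and $i_2<i_1$, let $j_3>j_1$ be smallest such that $(i_3,j_3)$ is large, replace $(i_1,j_1),(i_2,j_2),(i_3,j_3)$ by $(i_1,j_2),(i_2,j_3),(i_3,j_1)$ and set $j_1:=j_2$. (II) Then, if $\mathcal R_2\ne\emptyset$, let $t_0=\max\mathcal R_2$. If the arc $(i_0,t_0)$ is small, let $(i_1,t_1)$ be the large arc with smallest $t_1>t_0$ and replace these two arcs by $(i_0,t_1),(i_1,t_0)$. Start with $j_1=t_0$ and let $j_2$ run through the other elements of $\mathcal R_2$ from right to left: if $(i_2,j_2)$ is small, replace $(i_1,j_1),(i_2,j_2)$ by $(i_1,j_2),(i_2,j_1)$; in all cases set $j_1:=j_2$. Finally $\varphi(M)$ is the result together with the arc $(i,v)$. *The map $\varphi$ on partitions.* Given $P$, replace every arc $(x,y)$ by $(x^1,y^0)$, where the vertices are ordered by $1^0<1^1<2^0<2^1<\cdots$, apply $\varphi$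 to the resulting matching, and identify $x^0$ and $x^1$ with $x$ again; $\varphi(P)$ is the partition of $[n]$ with the arcs so obtained. **Theorem.** Let $S,T\subseteq[n]$ with $|S|=|T|$. The map $\varphi$ is well defined (the arcs produced from $M\in P_n(S,T)$ are exactly the arcs of the partition $\varphi(M)$), it is a bijection from $P_n(S,T)$ to itself, and $$\mathrm{pmaj}(M)=\mathrm{Cr}_2(\varphi(M))\qquad\text{for all } M\in P_n(S,T).$$ Consequently, for every $k$, the number of $M\in P_n(S,T)$ with $\mathrm{pmaj}(M)=k$ equals the number of $M\in P_n(S,T)$ with $\mathrm{Cr}_2(M)=k$. -/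

import Mathlib

namespace MatchingFoata

/-! ### Arcs

An arc is a pair `(i, j)` with `i < j`; `i` is its left-hand and `j` its right-hand endpoint.
In the arc sets below every vertex is the left-hand endpoint of at most one arc and the right-hand
endpoint of at most one arc. -/

/-- The set of right-hand endpoints of the arcs in `A`. -/
def rightEnds (A : Finset (ℕ × ℕ)) : Finset ℕ := A.image Prod.snd

/-- The left-hand endpoint of the (unique) arc of `A` whose right-hand endpoint is `j`. -/
def leftOf (A : Finset (ℕ × ℕ)) (j : ℕ) : ℕ := (A.filter fun e => e.2 = j).sup Prod.fst

/-- The arcs `e` and `f` form a 2-crossing, `e` being the one that starts first. -/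
def Crosses (e f : ℕ × ℕ) : Prop := e.1 < f.1 ∧ f.1 < e.2 ∧ e.2 < f.2

instance (e f : ℕ × ℕ) : Decidable (Crosses e f) := by unfold Crosses; infer_instance

/-- The number of 2-crossings of an arc set. -/
def arcCr2 (A : Finset (ℕ × ℕ)) : ℕ := ((A ×ˢ A).filter fun p => Crosses p.1 p.2).card

/-! ### The p-major index of an arc set -/

/-- The label of an arc: arcs are labelled `1, 2, …, k` by decreasing left-hand endpoints. -/
def label (A : Finset (ℕ × ℕ)) (e : ℕ × ℕ) : ℕ := (A.filter fun f => e.1 ≤ f.1).card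

/-- The label of the arc of `A` whose right-hand endpoint is `r`. -/
def labelAt (A : Finset (ℕ × ℕ)) (r : ℕ) : ℕ := label A (leftOf A r, r)

/-- The number of descents of a word. -/
def des : List ℕ → ℕ
  | a :: b :: l => (if b < a then 1 else 0) + des (b :: l)
  | _ => 0

/-- Given a right-hand endpoint `r` with `σ(r) = s` and the list of the right-hand endpoints to the
left of `r`, in decreasing order, the list of their sequences `σ`. To pass from `r` to the next
right-hand endpoint `r'`, the labels of the arcs whose left-hand endpoint is in `[r', r)` are
deleted (an arc that starts at `r'` counts as starting to the right of the arc ending at `r'`), and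
then the label of the arc ending at `r'` is put in front. -/
def sigmaFrom (A : Finset (ℕ × ℕ)) : ℕ → List ℕ → List ℕ → List (List ℕ)
  | _, _, [] => []
  | r, s, r' :: rest =>
    let s' := labelAt A r' ::
      s.filter fun a => ¬ ∃ e ∈ A, label A e = a ∧ r' ≤ e.1 ∧ e.1 < r
    s' :: sigmaFrom A r' s' rest

/-- The list `σ(r₁), σ(r₂), …, σ(rₖ)`, where `r₁ > r₂ > ⋯ > rₖ` are the right-hand endpoints. -/
def sigmas (A : Finset (ℕ × ℕ)) : List (List ℕ) :=
  match (rightEnds A).sort (· ≥ ·) with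
  | [] => []
  | r :: rest => [labelAt A r] :: sigmaFrom A r [labelAt A r] rest

/-- The p-major index of an arc set. -/
def arcPmaj (A : Finset (ℕ × ℕ)) : ℕ := ((sigmas A).map des).sum

/-! ### The regions determined by the last arc

Here `N` is a matching and `i` is the left-hand endpoint of an arc `(i, v)`, not in `N`, with `v`
to the right of all vertices of `N`. An arc `e` of `N` is large if `e.1 < i` and small if
`i < e.1`. -/

/-- The set `𝓡` of right-hand endpoints of `N` to the right of `i`. -/
def region (i : ℕ) (N : Finset (ℕ × ℕ)) : Finset ℕ := (rightEnds N).filter fun j => i < j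

/-- `e` is the critical large arc: the large arc with the biggest right-hand endpoint in `𝓡`. -/
def IsCriticalLarge (i : ℕ) (N : Finset (ℕ × ℕ)) (e : ℕ × ℕ) : Prop :=
  e ∈ N ∧ e.1 < i ∧ e.2 ∈ region i N ∧ ∀ f ∈ N, f.1 < i → f.2 ∈ region i N → f.2 ≤ e.2

instance (i : ℕ) (N : Finset (ℕ × ℕ)) (e : ℕ × ℕ) : Decidable (IsCriticalLarge i N e) := by
  unfold IsCriticalLarge; infer_instance

/-- `s` is the critical small arc: the small arc with the smallest left-hand endpoint among those
that cross the critical large arc. -/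
def IsCriticalSmall (i : ℕ) (N : Finset (ℕ × ℕ)) (s : ℕ × ℕ) : Prop :=
  ∃ e ∈ N, IsCriticalLarge i N e ∧ s ∈ N ∧ i < s.1 ∧ Crosses e s ∧
    ∀ f ∈ N, i < f.1 → Crosses e f → s.1 ≤ f.1

instance (i : ℕ) (N : Finset (ℕ × ℕ)) (s : ℕ × ℕ) : Decidable (IsCriticalSmall i N s) := by
  unfold IsCriticalSmall; infer_instance

/-- The set `𝓡₁(N)`; it is empty when there is no critical small arc. -/
def region1 (i : ℕ) (N : Finset (ℕ × ℕ)) : Finset ℕ :=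
  (region i N).filter fun j => ∃ s ∈ N, IsCriticalSmall i N s ∧ s.1 < j ∧ j ≤ s.2

/-- The set `𝓡₂(N)`; it is empty when there is no critical large arc. -/
def region2 (i : ℕ) (N : Finset (ℕ × ℕ)) : Finset ℕ :=
  (region i N).filter fun j =>
    (∃ s ∈ N, IsCriticalSmall i N s ∧ j < s.1) ∨
    ((¬ ∃ s ∈ N, IsCriticalSmall i N s) ∧ ∃ e ∈ N, IsCriticalLarge i N e ∧ j ≤ e.2)

/-! ### The two algorithms -/

/-- Replace the arcs `(i₁, j₁), (i₂, j₂)` of `A` by `(i₁, j₂), (i₂, j₁)`. -/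
def swapArcs (A : Finset (ℕ × ℕ)) (j₁ j₂ : ℕ) : Finset (ℕ × ℕ) :=
  (A \ {(leftOf A j₁, j₁), (leftOf A j₂, j₂)}) ∪ {(leftOf A j₁, j₂), (leftOf A j₂, j₁)}

/-- Replace the arcs `(i₁, j₁), (i₂, j₂), (i₃, j₃)` of `A` by `(i₁, j₂), (i₂, j₃), (i₃, j₁)`. -/
def rotateArcs (A : Finset (ℕ × ℕ)) (j₁ j₂ j₃ : ℕ) : Finset (ℕ × ℕ) :=
  (A \ {(leftOf A j₁, j₁), (leftOf A j₂, j₂), (leftOf A j₃, j₃)}) ∪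
    {(leftOf A j₁, j₂), (leftOf A j₂, j₃), (leftOf A j₃, j₁)}

/-- The right-hand endpoints greater than `j` of large arcs of `A`. -/
def largeEndsAfter (i : ℕ) (A : Finset (ℕ × ℕ)) (j : ℕ) : Finset ℕ :=
  (A.filter fun e => e.1 < i ∧ j < e.2).image Prod.snd

/-- One round of Algorithm I. The state is the current matching with the position of the first
pointer; `j₂` is the position of the second pointer. The cases are, in this order: `(i₂, j₂)` is
large; it is small and no right-hand endpoint is between `i₁` and `i₂`; there is one and `i₁ < i₂`;
there is one and `i₂ < i₁`. In the last case a large arc to the right of `j₁` always exists; the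
final `else` is never reached. -/
def stepI (i : ℕ) (st : Finset (ℕ × ℕ) × ℕ) (j₂ : ℕ) : Finset (ℕ × ℕ) × ℕ :=
  let A := st.1
  let j₁ := st.2
  let i₁ := leftOf A j₁
  let i₂ := leftOf A j₂
  if i₂ < i then (swapArcs A j₁ j₂, j₂)
  else if ¬ ∃ r ∈ rightEnds A, min i₁ i₂ < r ∧ r < max i₁ i₂ then (A, j₂)
  else if i₁ < i₂ then (A, j₁)
  else if h : (largeEndsAfter i A j₁).Nonempty then
    (rotateArcs A j₁ j₂ ((largeEndsAfter i A j₁).min' h), j₂)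
  else (A, j₁)

/-- Algorithm I on the set `R₁`: the first pointer starts at the largest element of `R₁` (which is
the right-hand endpoint of the critical small arc), the second runs through the other elements
from right to left. -/
def algorithmI (i : ℕ) (R₁ : Finset ℕ) (A : Finset (ℕ × ℕ)) : Finset (ℕ × ℕ) :=
  match R₁.sort (· ≥ ·) with
  | [] => A
  | p :: rest => (rest.foldl (stepI i) (A, p)).1

/-- The pre-processing (borrowing) step of Algorithm II at the vertex `t₀`. -/
def borrow (i : ℕ) (A : Finset (ℕ × ℕ)) (t₀ : ℕ) : Finset (ℕ × ℕ) :=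
  if i < leftOf A t₀ then
    if h : (largeEndsAfter i A t₀).Nonempty then swapArcs A t₀ ((largeEndsAfter i A t₀).min' h)
    else A
  else A

/-- One round of Algorithm II. -/
def stepII (i : ℕ) (st : Finset (ℕ × ℕ) × ℕ) (j₂ : ℕ) : Finset (ℕ × ℕ) × ℕ :=
  if leftOf st.1 j₂ < i then (st.1, j₂) else (swapArcs st.1 st.2 j₂, j₂)

/-- Algorithm II on the set `R₂`, with its pre-processing. -/
def algorithmII (i : ℕ) (R₂ : Finset ℕ) (A : Finset (ℕ × ℕ)) : Finset (ℕ × ℕ) :=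
  match R₂.sort (· ≥ ·) with
  | [] => A
  | t₀ :: rest => (rest.foldl (stepII i) (borrow i A t₀, t₀)).1

/-- The map `φ` on matchings (arc sets in which no vertex is used twice), by induction on the
number of arcs: the arc `(i, v)` ending at the last vertex `v` is removed, `φ` is applied to the
remaining matching, the two algorithms are run on the result `N`, with the regions of `N`, and the
arc `(i, v)` is put back. -/
def phi (M : Finset (ℕ × ℕ)) : Finset (ℕ × ℕ) :=
  if h : (rightEnds M).Nonempty then
    let v := (rightEnds M).max' h
    let i := leftOf M v
    let N := phi (M.filter fun e => e.2 ≠ v)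
    insert (i, v) (algorithmII i (region2 i N) (algorithmI i (region1 i N) N))
  else ∅
termination_by M.card
decreasing_by
  obtain ⟨e, he, hev⟩ := Finset.mem_image.1 ((rightEnds M).max'_mem h)
  exact Finset.card_lt_card (Finset.filter_ssubset.2 ⟨e, he, by simpa using hev⟩)

/-! ### Partitions of `[n] = {1, …, n}` -/

/-- The arcs of the standard representation: pairs of consecutive elements of a block. -/
def arcs {n : ℕ} (P : Finpartition (Finset.Icc 1 n)) : Finset (ℕ × ℕ) :=
  (Finset.Icc 1 n ×ˢ Finset.Icc 1 n).filter fun e =>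
    e.1 < e.2 ∧ ∃ B ∈ P.parts, e.1 ∈ B ∧ e.2 ∈ B ∧ ∀ c ∈ B, ¬ (e.1 < c ∧ c < e.2)

/-- The number of 2-crossings of a partition. -/
def Cr2 {n : ℕ} (P : Finpartition (Finset.Icc 1 n)) : ℕ := arcCr2 (arcs P)

/-- The p-major index of a partition. -/
def pmaj {n : ℕ} (P : Finpartition (Finset.Icc 1 n)) : ℕ := arcPmaj (arcs P)

/-- The set of minimal block elements. -/
def minElems {n : ℕ} (P : Finpartition (Finset.Icc 1 n)) : Finset ℕ :=
  (Finset.Icc 1 n).filter fun x => ∃ B ∈ P.parts, x ∈ B ∧ ∀ y ∈ B, x ≤ y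

/-- The set of maximal block elements. -/
def maxElems {n : ℕ} (P : Finpartition (Finset.Icc 1 n)) : Finset ℕ :=
  (Finset.Icc 1 n).filter fun x => ∃ B ∈ P.parts, x ∈ B ∧ ∀ y ∈ B, y ≤ x

/-- The set `P_n(S, T)` of partitions of `[n]` with minimal block elements `S` and maximal block
elements `T`. -/
def partitionsWith (n : ℕ) (S T : Finset ℕ) : Finset (Finpartition (Finset.Icc 1 n)) :=
  Finset.univ.filter fun P => minElems P = S ∧ maxElems P = T

/-- The passage from the arcs of a partition to a matching: a vertex `x` becomes `x⁰ = 2x` as a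
right-hand endpoint and `x¹ = 2x + 1` as a left-hand endpoint. -/
def splitArcs (A : Finset (ℕ × ℕ)) : Finset (ℕ × ℕ) := A.image fun e => (2 * e.1 + 1, 2 * e.2)

/-- The reverse passage: `x⁰ = 2x` and `x¹ = 2x + 1` are identified with `x`. -/
def mergeArcs (A : Finset (ℕ × ℕ)) : Finset (ℕ × ℕ) := A.image fun e => (e.1 / 2, e.2 / 2)

open Classical in
/-- The partition of `[n]` whose blocks are the connected components of the graph with arc set
`A`. -/
noncomputable def ofArcs (n : ℕ) (A : Finset (ℕ × ℕ)) : Finpartition (Finset.Icc 1 n) :=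
  Finpartition.ofSetSetoid (Relation.EqvGen.setoid fun a b => (a, b) ∈ A) (Finset.Icc 1 n)

/-- The arc set of the image of a partition under the generalized Foata map. -/
def foataArcs {n : ℕ} (P : Finpartition (Finset.Icc 1 n)) : Finset (ℕ × ℕ) :=
  mergeArcs (phi (splitArcs (arcs P)))

/-- The generalized Foata map `φ` on partitions of `[n]`. -/
noncomputable def foataMap {n : ℕ} (P : Finpartition (Finset.Icc 1 n)) :
    Finpartition (Finset.Icc 1 n) :=
  ofArcs n (foataArcs P)

end MatchingFoata

/-! A matching is a set `R` of right-hand endpoints with an injective function `f` giving the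
left-hand endpoints. Every move of the algorithms precomposes `f` with transpositions of `R`, so the
two endpoint sets never change. The proof is by induction on the arc `(i, v)` ending at the last
vertex, with `N` the image of the remaining matching and `b` the last right-hand endpoint of the
second region (`b = i` if that region is empty).

Growth of the p-major index. The word `σ(r)` lists the labels of the arcs over `r` by increasing
right-hand endpoint, and a descent is an increase of left-hand endpoints. The arc `(i, v)` puts a
new last letter on `σ(r)` for each `r > i` in `R`. The letter before it belongs to the arc over `r`
that reaches farthest, and this arc is not nested in another one. So a descent appears at `r`
exactly when no non-nested ("exposed") arc starts strictly between `i` and `r` (`majNum_insert`).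
The map preserves the exposed left-hand endpoints, because the large arcs keep the relative order of
their right-hand endpoints (`Rearr.exposed_filter`). Hence these `r` can be read off from `N`, where
they form exactly `R ∩ (i, b]` (`Run.freeEnds_eq`).

Growth of the crossing number. The first algorithm loses one crossing for each large arc ending
after `b`; the second gains one for each small arc ending in `(i, b]`. The new arc crosses every
large arc ending after `i`, and their number depends on the endpoint sets only. The total gain is
again `|R ∩ (i, b]|` (`Run.crossNum_add`).

Bijectivity. The sets are finite, so injectivity suffices. The bound `b` is visible in the result:
the arc ending at the first right-hand endpoint after `b` starts after `b`, while every arc ending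
in `(i, b]` is large or has a right-hand endpoint strictly between its two ends (`Run.bound_le`).
With `b` known, the rounds are undone one by one (`RunII.injective`, `StepI.injective`).

For partitions, splitting each vertex into an even and an odd copy gives a matching with the same
crossings and the same p-major index. The minimal and maximal block elements are the complements of
the endpoint sets, so they are preserved. -/

namespace MatchingFoata

/-! ### Arc sets as functions from right-hand to left-hand endpoints -/

/-- The arc set with right-hand endpoints `R` in which the arc ending at `j` starts at `f j`. -/
def mkArcs (R : Finset ℕ) (f : ℕ → ℕ) : Finset (ℕ × ℕ) := R.image fun j => (f j, j)

section mkArcs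

variable {R : Finset ℕ} {f g : ℕ → ℕ}

theorem mem_mkArcs {e : ℕ × ℕ} : e ∈ mkArcs R f ↔ e.2 ∈ R ∧ e.1 = f e.2 := by
  obtain ⟨x, y⟩ := e
  simp only [mkArcs, Finset.mem_image, Prod.mk.injEq]
  constructor
  · rintro ⟨j, hj, rfl, rfl⟩; exact ⟨hj, rfl⟩
  · rintro ⟨hj, rfl⟩; exact ⟨y, hj, rfl, rfl⟩

@[simp] theorem pair_mem_mkArcs {x y : ℕ} : (x, y) ∈ mkArcs R f ↔ y ∈ R ∧ x = f y := mem_mkArcs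

theorem exists_mem_mkArcs {p : ℕ × ℕ → Prop} :
    (∃ e ∈ mkArcs R f, p e) ↔ ∃ j ∈ R, p (f j, j) := by
  simp [mkArcs]

theorem forall_mem_mkArcs {p : ℕ × ℕ → Prop} :
    (∀ e ∈ mkArcs R f, p e) ↔ ∀ j ∈ R, p (f j, j) := by
  simp [mkArcs]

theorem mkArcs_congr (h : Set.EqOn f g R) : mkArcs R f = mkArcs R g :=
  Finset.image_congr fun j hj => by simp [h hj]

theorem mkArcs_inj : mkArcs R f = mkArcs R g ↔ Set.EqOn f g R := by
  refine ⟨fun h j hj => ?_, mkArcs_congr⟩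
  have : (f j, j) ∈ mkArcs R g := h ▸ pair_mem_mkArcs.2 ⟨hj, rfl⟩
  exact (pair_mem_mkArcs.1 this).2

@[simp] theorem rightEnds_mkArcs : rightEnds (mkArcs R f) = R := by
  ext j; simp [rightEnds, mkArcs]

@[simp] theorem leftOf_mkArcs {j : ℕ} (hj : j ∈ R) : leftOf (mkArcs R f) j = f j := by
  have : (mkArcs R f).filter (fun e => e.2 = j) = {(f j, j)} := by
    ext ⟨x, y⟩
    simp only [Finset.mem_filter, pair_mem_mkArcs, Finset.mem_singleton, Prod.mk.injEq]
    constructor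
    · rintro ⟨⟨_, rfl⟩, rfl⟩; exact ⟨rfl, rfl⟩
    · rintro ⟨rfl, rfl⟩; exact ⟨⟨hj, rfl⟩, rfl⟩
  simp [leftOf, this]

theorem eq_mkArcs {A : Finset (ℕ × ℕ)}
    (h : ∀ e ∈ A, ∀ e' ∈ A, e.2 = e'.2 → e = e') : A = mkArcs (rightEnds A) (leftOf A) := by
  have key : ∀ e ∈ A, leftOf A e.2 = e.1 := by
    intro e he
    have : A.filter (fun e' => e'.2 = e.2) = {e} := by
      ext e'
      simp only [Finset.mem_filter, Finset.mem_singleton]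
      exact ⟨fun ⟨h1, h2⟩ => h _ h1 _ he h2, fun h1 => by subst h1; exact ⟨he, rfl⟩⟩
    simp [leftOf, this]
  ext e
  rw [mem_mkArcs]
  constructor
  · intro he; exact ⟨Finset.mem_image_of_mem _ he, (key e he).symm⟩
  · rintro ⟨h1, h2⟩
    obtain ⟨e', he', h3⟩ := Finset.mem_image.1 h1
    have : e = e' := Prod.ext (by rw [h2, ← h3, key e' he']) h3.symm
    exact this ▸ he'

theorem filter_mkArcs_ne (v : ℕ) :
    (mkArcs R f).filter (fun e => e.2 ≠ v) = mkArcs (R.erase v) f := by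
  ext ⟨x, y⟩; simp; tauto

theorem insert_mkArcs {v : ℕ} (hv : v ∈ R) :
    insert (f v, v) (mkArcs (R.erase v) f) = mkArcs R f := by
  rw [← Finset.insert_erase hv, mkArcs, mkArcs, Finset.image_insert, Finset.erase_insert (by simp)]

theorem swapArcs_mkArcs {a b : ℕ} (ha : a ∈ R) (hb : b ∈ R) (hab : a ≠ b) :
    swapArcs (mkArcs R f) a b = mkArcs R (f ∘ Equiv.swap a b) := by
  ext ⟨x, y⟩
  simp only [swapArcs, leftOf_mkArcs ha, leftOf_mkArcs hb, Finset.mem_union, Finset.mem_sdiff,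
    pair_mem_mkArcs, Finset.mem_insert, Finset.mem_singleton, Prod.mk.injEq, Function.comp]
  by_cases h1 : y = a
  · subst h1; simp [ha, hab]
  · by_cases h2 : y = b
    · subst h2; simp [hb, h1]
    · simp [h1, h2, Equiv.swap_apply_of_ne_of_ne h1 h2]

/-- A rotation is a product of two transpositions, so its effect on crossings follows from that of
single swaps. -/
theorem rotateArcs_mkArcs {a b c : ℕ} (ha : a ∈ R) (hb : b ∈ R) (hc : c ∈ R) (hab : a ≠ b)
    (hac : a ≠ c) (hbc : b ≠ c) :
    rotateArcs (mkArcs R f) a b c = mkArcs R ((f ∘ Equiv.swap a b) ∘ Equiv.swap a c) := by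
  ext ⟨x, y⟩
  simp only [rotateArcs, leftOf_mkArcs ha, leftOf_mkArcs hb, leftOf_mkArcs hc, Finset.mem_union,
    Finset.mem_sdiff, pair_mem_mkArcs, Finset.mem_insert, Finset.mem_singleton, Prod.mk.injEq,
    Function.comp]
  by_cases h1 : y = a
  · subst h1; simp [ha, hab, hac, Equiv.swap_apply_of_ne_of_ne hac.symm hbc.symm]
  · by_cases h2 : y = b
    · subst h2; simp [hb, h1, hbc, Equiv.swap_apply_of_ne_of_ne h1 hbc]
    · by_cases h3 : y = c
      · subst h3; simp [hc, h1, h2]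
      · simp [h1, h2, h3, Equiv.swap_apply_of_ne_of_ne h1 h3, Equiv.swap_apply_of_ne_of_ne h1 h2]

theorem largeEndsAfter_mkArcs (i j : ℕ) :
    largeEndsAfter i (mkArcs R f) j = R.filter fun p => f p < i ∧ j < p := by
  ext p
  simp only [largeEndsAfter, Finset.mem_image, Finset.mem_filter, Prod.exists, pair_mem_mkArcs]
  constructor
  · rintro ⟨x, y, ⟨⟨h1, rfl⟩, h2, h3⟩, rfl⟩; exact ⟨h1, h2, h3⟩
  · rintro ⟨h1, h2, h3⟩; exact ⟨_, _, ⟨⟨h1, rfl⟩, h2, h3⟩, rfl⟩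

end mkArcs

/-! ### The number of crossings -/

/-- The indicator of a crossing between the arcs ending at `p` and `q`, the first being the one
that starts first. -/
def crossInd (f : ℕ → ℕ) (p q : ℕ) : ℕ := if f p < f q ∧ f q < p ∧ p < q then 1 else 0

/-- The number of crossings of `mkArcs R f`. -/
def crossNum (R : Finset ℕ) (f : ℕ → ℕ) : ℕ := ∑ p ∈ R, ∑ q ∈ R, crossInd f p q

theorem arcCr2_mkArcs (R : Finset ℕ) (f : ℕ → ℕ) : arcCr2 (mkArcs R f) = crossNum R f := by
  have hinj : Set.InjOn (fun j => (f j, j)) (R : Set ℕ) := fun a _ b _ h => by simp_all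
  rw [arcCr2, Finset.card_filter, Finset.sum_product, mkArcs, Finset.sum_image hinj]
  refine Finset.sum_congr rfl fun p _ => ?_
  rw [Finset.sum_image hinj]
  rfl

/-- Isolates the two arcs about to be swapped: the crossings among the others are unaffected, and
only the last sum needs an argument. -/
theorem crossNum_insert_insert {R : Finset ℕ} {f : ℕ → ℕ} {a b : ℕ} (hab : a ≠ b) (ha : a ∉ R)
    (hb : b ∉ R) :
    crossNum (insert a (insert b R)) f = crossNum R f + (crossInd f a b + crossInd f b a) +
      ∑ p ∈ R, ((crossInd f p a + crossInd f a p) + (crossInd f p b + crossInd f b p)) := by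
  have h1 : a ∉ insert b R := by simp [hab, ha]
  have h0 : ∀ p, crossInd f p p = 0 := fun p => by simp [crossInd]
  simp only [crossNum, Finset.sum_insert h1, Finset.sum_insert hb, Finset.sum_add_distrib, h0]
  ring

theorem crossNum_congr {R : Finset ℕ} {f g : ℕ → ℕ} (h : Set.EqOn f g R) :
    crossNum R f = crossNum R g :=
  Finset.sum_congr rfl fun p hp => Finset.sum_congr rfl fun q hq => by
    simp [crossInd, h hp, h hq]

/-- Turning two nested arcs into two crossing ones. -/
theorem crossNum_swap_of_nested {R : Finset ℕ} {f : ℕ → ℕ} (hf : Set.InjOn f R) {a b : ℕ}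
    (ha : a ∈ R) (hb : b ∈ R) (hab : a < b) (h1 : f b < f a) (h2 : f a < a)
    (h3 : ∀ p ∈ R, a < p → p < b → f p < f b ∨ f a < f p) :
    crossNum R (f ∘ Equiv.swap a b) = crossNum R f + 1 := by
  obtain ⟨Q, rfl, haQ, hbQ⟩ : ∃ Q, R = insert a (insert b Q) ∧ a ∉ Q ∧ b ∉ Q := by
    refine ⟨(R.erase a).erase b, ?_, by simp, by simp⟩
    rw [Finset.insert_erase (by simp [hb, hab.ne']), Finset.insert_erase ha]
  rw [crossNum_insert_insert hab.ne haQ hbQ, crossNum_insert_insert hab.ne haQ hbQ]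
  have e1 : crossNum Q (f ∘ Equiv.swap a b) = crossNum Q f := by
    refine crossNum_congr fun p hp => ?_
    have hpa : p ≠ a := fun h => haQ (h ▸ hp)
    have hpb : p ≠ b := fun h => hbQ (h ▸ hp)
    simp [Equiv.swap_apply_of_ne_of_ne hpa hpb]
  -- Only a third arc ending between `a` and `b` and starting between `f b` and `f a` could notice
  -- the swap, and `h3` excludes it.
  have e2 : ∀ p ∈ Q, ((crossInd (f ∘ Equiv.swap a b) p a + crossInd (f ∘ Equiv.swap a b) a p) +
      (crossInd (f ∘ Equiv.swap a b) p b + crossInd (f ∘ Equiv.swap a b) b p)) =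
      ((crossInd f p a + crossInd f a p) + (crossInd f p b + crossInd f b p)) := by
    intro p hp
    have hpa : p ≠ a := fun h => haQ (h ▸ hp)
    have hpb : p ≠ b := fun h => hbQ (h ▸ hp)
    have hpR : p ∈ insert a (insert b Q) := by simp [hp]
    have hfa : f p ≠ f a := fun h => hpa (hf hpR ha h)
    have hfb : f p ≠ f b := fun h => hpb (hf hpR hb h)
    have h4 := h3 p hpR
    simp only [crossInd, Function.comp, Equiv.swap_apply_left, Equiv.swap_apply_right,
      Equiv.swap_apply_of_ne_of_ne hpa hpb]
    clear h3 e1 hpR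
    generalize f p = x at *
    generalize f a = y at *
    generalize f b = z at *
    rcases lt_or_gt_of_ne hpa with h5 | h5 <;> rcases lt_or_gt_of_ne hpb with h6 | h6 <;>
      simp only [h5, h6, h5.not_gt, h6.not_gt, and_true, and_false, if_false, add_zero, zero_add]
    · ring
    · split_ifs <;> omega
    · split_ifs <;> omega
    · split_ifs <;> omega
  rw [e1, Finset.sum_congr rfl e2]
  simp only [crossInd, Function.comp, Equiv.swap_apply_left, Equiv.swap_apply_right]
  have : ¬ (b < a) := by omega
  simp only [this, and_false, if_false]
  rw [if_pos ⟨h1, h2, hab⟩, if_neg (by omega)]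
  omega

/-- Turning two crossing arcs into two nested ones. -/
theorem crossNum_swap_of_crossing {R : Finset ℕ} {f : ℕ → ℕ} (hf : Set.InjOn f R) {a b : ℕ}
    (ha : a ∈ R) (hb : b ∈ R) (hab : a < b) (h1 : f a < f b) (h2 : f b < a)
    (h3 : ∀ p ∈ R, a < p → p < b → f p < f a ∨ f b < f p) :
    crossNum R f = crossNum R (f ∘ Equiv.swap a b) + 1 := by
  have hmap : ∀ p ∈ R, Equiv.swap a b p ∈ R := fun p hp => by
    by_cases h : p = a
    · subst h; simpa
    by_cases h' : p = b
    · subst h'; simpa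
    rwa [Equiv.swap_apply_of_ne_of_ne h h']
  have := crossNum_swap_of_nested (f := f ∘ Equiv.swap a b) (R := R)
    (fun p hp q hq h => (Equiv.swap a b).injective (hf (hmap p hp) (hmap q hq) h)) ha hb hab
    (by simpa) (by simpa) (fun p hp hap hpb => by
      simpa [Equiv.swap_apply_of_ne_of_ne hap.ne' hpb.ne] using h3 p hp hap hpb)
  rw [← this]
  congr 1
  ext p; simp

/-! ### Matchings and rearrangements of their arcs -/

/-- `mkArcs R f` is a matching with `f j < j` for its arcs `(f j, j)`. -/
structure IsMatch (R : Finset ℕ) (f : ℕ → ℕ) : Prop where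
  inj : Set.InjOn f R
  lt : ∀ p ∈ R, f p < p
  not_mem : ∀ p ∈ R, f p ∉ R

/-- The matching `g` has the same vertex types as `f`, and its arcs that start to the left of `i`
have right-hand endpoints in the same relative order as in `f`. -/
structure Rearr (i : ℕ) (R : Finset ℕ) (f g : ℕ → ℕ) : Prop where
  isMatch : IsMatch R g
  image_eq : R.image g = R.image f
  order : ∀ p ∈ R, ∀ p' ∈ R, ∀ q ∈ R, ∀ q' ∈ R, f p = g q → f p' = g q' → f p < i → f p' < i →
    p < p' → q < q'

theorem comp_swap_apply (f : ℕ → ℕ) (a b p : ℕ) :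
    (f ∘ Equiv.swap a b) p = if p = a then f b else if p = b then f a else f p := by
  simp only [Function.comp, Equiv.swap_apply_def]
  split_ifs <;> rfl

theorem swap_mem {R : Finset ℕ} {a b p : ℕ} (ha : a ∈ R) (hb : b ∈ R) (hp : p ∈ R) :
    Equiv.swap a b p ∈ R := by
  rw [Equiv.swap_apply_def]; split_ifs <;> assumption

theorem image_comp_swap {R : Finset ℕ} {a b : ℕ} (f : ℕ → ℕ) (ha : a ∈ R) (hb : b ∈ R) :
    R.image (f ∘ Equiv.swap a b) = R.image f := by
  ext x
  simp only [Finset.mem_image, Function.comp]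
  constructor
  · rintro ⟨p, hp, rfl⟩; exact ⟨_, swap_mem ha hb hp, rfl⟩
  · rintro ⟨p, hp, rfl⟩; exact ⟨_, swap_mem ha hb hp, by simp⟩

theorem IsMatch.swap {R : Finset ℕ} {f : ℕ → ℕ} (hf : IsMatch R f) {a b : ℕ} (ha : a ∈ R)
    (hb : b ∈ R) (h1 : f a < b) (h2 : f b < a) : IsMatch R (f ∘ Equiv.swap a b) where
  inj p hp q hq h := (Equiv.swap a b).injective (hf.inj (swap_mem ha hb hp) (swap_mem ha hb hq) h)
  lt p hp := by
    rw [comp_swap_apply]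
    split_ifs with h h'
    · exact h ▸ h2
    · exact h' ▸ h1
    · exact hf.lt p hp
  not_mem p hp := hf.not_mem _ (swap_mem ha hb hp)

namespace Rearr

variable {i : ℕ} {R : Finset ℕ} {f g h : ℕ → ℕ}

theorem refl (hf : IsMatch R f) : Rearr i R f f where
  isMatch := hf
  image_eq := rfl
  order p hp p' hp' q hq q' hq' e e' _ _ hlt := by
    rwa [← hf.inj hp hq e, ← hf.inj hp' hq' e']

theorem exists_right (hfg : Rearr i R f g) {p : ℕ} (hp : p ∈ R) : ∃ q ∈ R, g q = f p := by
  have : f p ∈ R.image g := hfg.image_eq ▸ Finset.mem_image_of_mem f hp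
  simpa using this

theorem exists_left (hfg : Rearr i R f g) {p : ℕ} (hp : p ∈ R) : ∃ q ∈ R, f q = g p := by
  have : g p ∈ R.image f := hfg.image_eq ▸ Finset.mem_image_of_mem g hp
  simpa using this

theorem trans (hfg : Rearr i R f g) (hgh : Rearr i R g h) : Rearr i R f h where
  isMatch := hgh.isMatch
  image_eq := hgh.image_eq.trans hfg.image_eq
  order p hp p' hp' q hq q' hq' e e' h1 h2 hlt := by
    obtain ⟨m, hm, em⟩ := hfg.exists_right hp
    obtain ⟨m', hm', em'⟩ := hfg.exists_right hp'
    exact hgh.order m hm m' hm' q hq q' hq' (em.trans e) (em'.trans e') (em ▸ h1) (em' ▸ h2)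
      (hfg.order p hp p' hp' m hm m' hm' em.symm em'.symm h1 h2 hlt)

theorem ne_of_ne (hfg : Rearr i R f g) {x : ℕ} (hx : ∀ p ∈ R, f p ≠ x) : ∀ p ∈ R, g p ≠ x := by
  intro p hp
  obtain ⟨q, hq, e⟩ := hfg.exists_left hp
  exact e ▸ hx q hq

/-- Since `i ≤ f a`, at most the arc ending at `b` is large. When it is, its right-hand endpoint
moves to `a` without passing that of another large arc, so the order of the large arcs survives. -/
theorem swap (hf : IsMatch R f) {a b : ℕ} (ha : a ∈ R) (hb : b ∈ R) (h1 : f a < b) (h2 : f b < a)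
    (h3 : i ≤ f a) (h4 : f b < i → ∀ p ∈ R, (a < p ∧ p < b) ∨ (b < p ∧ p < a) → i ≤ f p) :
    Rearr i R f (f ∘ Equiv.swap a b) where
  isMatch := hf.swap ha hb h1 h2
  image_eq := image_comp_swap f ha hb
  order p hp p' hp' q hq q' hq' e e' hi hi' hlt := by
    have key : ∀ p ∈ R, ∀ q ∈ R, f p = (f ∘ Equiv.swap a b) q → f p < i →
        p ≠ a ∧ q = if p = b then a else p := by
      intro p hp q hq e hi
      have hpa : p ≠ a := by rintro rfl; omega
      have : p = Equiv.swap a b q := hf.inj hp (swap_mem ha hb hq) e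
      refine ⟨hpa, ?_⟩
      have : q = Equiv.swap a b p := by simp [this]
      rw [this, Equiv.swap_apply_def, if_neg hpa]
    obtain ⟨n1, r1⟩ := key p hp q hq e hi
    obtain ⟨n2, r2⟩ := key p' hp' q' hq' e' hi'
    rw [r1, r2]
    split_ifs with c1 c2 c2
    · omega
    · subst c1
      have := fun h => h4 hi p' hp' (Or.inr h)
      omega
    · subst c2
      have := fun h => h4 hi' p hp (Or.inl h)
      omega
    · exact hlt

end Rearr

/-! ### The first algorithm

The vertices to the right of `b` are processed from right to left. A left-hand endpoint `x > b` is
adjacent to `b` if no right-hand endpoint is between, and high otherwise. -/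

/-- There is no right-hand endpoint between `b` and `x > b`. -/
def Adjoins (b : ℕ) (R : Finset ℕ) (x : ℕ) : Prop := b < x ∧ ∀ r ∈ R, b < r → x ≤ r

/-- There is a right-hand endpoint between `b` and `x > b`. -/
def High (b : ℕ) (R : Finset ℕ) (x : ℕ) : Prop := b < x ∧ ∃ r ∈ R, b < r ∧ r < x

theorem Adjoins.not_high {b : ℕ} {R : Finset ℕ} {x : ℕ} (h : Adjoins b R x) : ¬ High b R x := by
  rintro ⟨_, r, hr, h1, h2⟩
  exact absurd (h.2 r hr h1) (by omega)

theorem adjoins_or_high {b : ℕ} {R : Finset ℕ} {x : ℕ} (h : b < x) :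
    Adjoins b R x ∨ High b R x := by
  by_cases hr : ∃ r ∈ R, b < r ∧ r < x
  · exact Or.inr ⟨h, hr⟩
  · push Not at hr
    exact Or.inl ⟨h, hr⟩

theorem Adjoins.lt_high {b : ℕ} {R : Finset ℕ} {x y : ℕ} (hx : Adjoins b R x)
    (hy : High b R y) : x < y := by
  obtain ⟨_, r, hr, h1, h2⟩ := hy
  exact (hx.2 r hr h1).trans_lt h2

/-- One round of the first algorithm, for functions. -/
inductive StepI (i b : ℕ) (R : Finset ℕ) : (ℕ → ℕ) → ℕ → ℕ → (ℕ → ℕ) → ℕ → Prop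
  | large {f : ℕ → ℕ} {j j' : ℕ} : f j' < i → StepI i b R f j j' (f ∘ Equiv.swap j j') j'
  | adjoins {f : ℕ → ℕ} {j j' : ℕ} : Adjoins b R (f j') → StepI i b R f j j' f j'
  | high {f : ℕ → ℕ} {j j' : ℕ} : High b R (f j') → StepI i b R f j j' f j
  | low {f : ℕ → ℕ} {j j' k : ℕ} : i < f j' → f j' < b → k ∈ R → j < k → f k < i →
      (∀ p ∈ R, j < p → p < k → ¬ f p < i) →
      StepI i b R f j j' ((f ∘ Equiv.swap j j') ∘ Equiv.swap j k) j'

/-- The first algorithm along a list of vertices, for functions. -/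
inductive RunI (i b : ℕ) (R : Finset ℕ) : (ℕ → ℕ) → ℕ → List ℕ → (ℕ → ℕ) → ℕ → Prop
  | nil {f : ℕ → ℕ} {j : ℕ} : RunI i b R f j [] f j
  | cons {f g h : ℕ → ℕ} {j j' k m : ℕ} {l : List ℕ} : StepI i b R f j j' g k →
      RunI i b R g k l h m → RunI i b R f j (j' :: l) h m

/-- The invariant of the first algorithm: `j` is the first pointer and the vertices from `cur` on
have been processed. -/
structure InvI (i b : ℕ) (R : Finset ℕ) (f : ℕ → ℕ) (j cur : ℕ) : Prop where
  isMatch : IsMatch R f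
  ne : ∀ p ∈ R, f p ≠ i
  mem : j ∈ R
  b_lt : b < cur
  le : cur ≤ j
  adj : Adjoins b R (f j)
  high : ∀ p ∈ R, cur ≤ p → p < j → High b R (f p)
  first : ∀ p ∈ R, j < p → f p < b → ∃ p' ∈ R, j < p' ∧ p' ≤ p ∧ f p' < i
  low : ∀ p ∈ R, p < cur → i < f p → f p < b → ∃ p' ∈ R, p < p' ∧ f p' < i

/-- `b` is `i` or a right-hand endpoint to the right of `i`. -/
structure Frame (i b : ℕ) (R : Finset ℕ) : Prop where
  not_mem : i ∉ R
  le : i ≤ b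
  mem : b = i ∨ b ∈ R

theorem Frame.ne {i b : ℕ} {R : Finset ℕ} (h : Frame i b R) {f : ℕ → ℕ} (hf : IsMatch R f)
    (hi : ∀ p ∈ R, f p ≠ i) {p : ℕ} (hp : p ∈ R) : f p ≠ b := by
  rcases h.mem with rfl | hb
  · exact hi p hp
  · intro e; exact hf.not_mem p hp (e ▸ hb)

section

variable {i b : ℕ} {R : Finset ℕ} {f g : ℕ → ℕ} {j j' k cur : ℕ}

theorem InvI.adj_lt (hI : InvI i b R f j cur) {p : ℕ} (hp : p ∈ R) (hbp : b < p) : f j < p :=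
  lt_of_le_of_ne (hI.adj.2 p hp hbp) fun e => hI.isMatch.not_mem j hI.mem (e ▸ hp)

/-- The field `low` gives a large arc to the right of `j'`. It cannot end at or before the pointer,
where only high arcs and the adjacent one occur. Hence the final `else` of `stepI` is never reached.
-/
theorem InvI.exists_large (hI : InvI i b R f j cur) (hF : Frame i b R) (hj' : j' ∈ R)
    (hlt : j' < cur) (hpred : ∀ p ∈ R, j' < p → cur ≤ p) (h1 : i < f j') (h2 : f j' < b) :
    ∃ p ∈ R, j < p ∧ f p < i := by
  obtain ⟨p, hp, h3, h4⟩ := hI.low j' hj' hlt h1 h2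
  refine ⟨p, hp, ?_, h4⟩
  by_contra h5
  have h6 := hF.le
  rcases eq_or_lt_of_le (not_lt.1 h5) with rfl | h7
  · have := hI.adj.1; omega
  · have := (hI.high p hp (hpred p hp h3) h7).1; omega

/-- The test in `stepI` compares `f j` with `f j'`. As `f j` adjoins `b`, its outcome only depends
on the position of `f j'` relative to `b`: large, low, adjacent or high. -/
theorem exists_stepI (hI : InvI i b R f j cur) (hF : Frame i b R) (hj' : j' ∈ R)
    (hlt : j' < cur) (hpred : ∀ p ∈ R, j' < p → cur ≤ p) :
    ∃ g k, StepI i b R f j j' g k ∧ stepI i (mkArcs R f, j) j' = (mkArcs R g, k) := by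
  have hjj : j' < j := hlt.trans_le hI.le
  have hib := hF.le
  have hadj := hI.adj
  by_cases h1 : f j' < i
  · refine ⟨_, _, .large h1, ?_⟩
    simp [stepI, hj', h1, swapArcs_mkArcs hI.mem hj' hjj.ne']
  have h1' : i < f j' := lt_of_le_of_ne (not_lt.1 h1) (hI.ne j' hj').symm
  rcases lt_or_gt_of_ne (hF.ne hI.isMatch hI.ne hj') with h2 | h2
  · obtain ⟨p, hp, h3, h4⟩ := hI.exists_large hF hj' hlt hpred h1' h2
    have hne : (largeEndsAfter i (mkArcs R f) j).Nonempty := by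
      rw [largeEndsAfter_mkArcs]
      exact ⟨p, by simp [hp, h3, h4]⟩
    obtain ⟨k, hk⟩ : ∃ k, k = (largeEndsAfter i (mkArcs R f) j).min' hne := ⟨_, rfl⟩
    have hk1 : k ∈ R ∧ f k < i ∧ j < k := by
      have := Finset.min'_mem _ hne
      rw [← hk, largeEndsAfter_mkArcs] at this
      simpa using this
    have hk2 : ∀ p ∈ R, j < p → p < k → ¬ f p < i := by
      intro p hp hjp hpk hpi
      have := Finset.min'_le (largeEndsAfter i (mkArcs R f) j) p
        (by rw [largeEndsAfter_mkArcs]; simp [hp, hpi, hjp])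
      omega
    -- A low left-hand endpoint lies strictly between `i` and `b`, so `b ≠ i`. Then `b` itself is
    -- the right-hand endpoint separating `f j'` from `f j`.
    have hbR : b ∈ R := by
      rcases hF.mem with h | h
      · omega
      · exact h
    have hex : ∃ r ∈ R, min (f j) (f j') < r ∧ r < max (f j) (f j') :=
      ⟨b, hbR, by have := hadj.1; omega, by have := hadj.1; omega⟩
    refine ⟨_, _, .low h1' h2 hk1.1 hk1.2.2 hk1.2.1 hk2, ?_⟩
    have h5 : ¬ f j < f j' := by have := hadj.1; omega
    simp only [stepI, leftOf_mkArcs hj', leftOf_mkArcs hI.mem, rightEnds_mkArcs, if_neg h1, hex,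
      not_true, if_false, if_neg h5, dif_pos hne]
    rw [← hk, rotateArcs_mkArcs hI.mem hj' hk1.1 hjj.ne' hk1.2.2.ne (by omega)]
  · rcases adjoins_or_high (R := R) h2 with h3 | h3
    · refine ⟨_, _, .adjoins h3, ?_⟩
      have hex : ¬ ∃ r ∈ R, min (f j) (f j') < r ∧ r < max (f j) (f j') := by
        rintro ⟨r, hr, h4, h5⟩
        have hbr : b < r := by have := hadj.1; omega
        have h6 := hadj.2 r hr hbr
        have h7 := h3.2 r hr hbr
        omega
      simp only [stepI, leftOf_mkArcs hj', leftOf_mkArcs hI.mem, rightEnds_mkArcs, if_neg h1, hex,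
        not_false_eq_true, if_true]
    · refine ⟨_, _, .high h3, ?_⟩
      have hex : ∃ r ∈ R, min (f j) (f j') < r ∧ r < max (f j) (f j') := by
        obtain ⟨_, r, hr, h4, h5⟩ := h3
        have h6 := hadj.2 r hr h4
        have h7 : f j ≠ r := fun e => hI.isMatch.not_mem j hI.mem (e ▸ hr)
        exact ⟨r, hr, by omega, by omega⟩
      simp only [stepI, leftOf_mkArcs hj', leftOf_mkArcs hI.mem, rightEnds_mkArcs, if_neg h1, hex,
        not_true, if_false, if_pos (hadj.lt_high h3)]

/-- What one round of the first algorithm does. -/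
structure StepIProps (i b : ℕ) (R : Finset ℕ) (f : ℕ → ℕ) (j' : ℕ) (g : ℕ → ℕ) (k : ℕ) :
    Prop where
  inv : InvI i b R g k j'
  rearr : Rearr i R f g
  eq_of_lt : ∀ p ∈ R, p < j' → g p = f p
  high_iff : ∀ p ∈ R, High b R (g p) ↔ High b R (f p)
  cross : crossNum R f = crossNum R g + if f j' < i then 1 else 0

/-- Every arc ending strictly between `j'` and the pointer is high, so it starts to the right of `f
j`. This is what makes each swap change the number of crossings by exactly one. -/
theorem StepI.props (hI : InvI i b R f j cur) (hF : Frame i b R) (hj' : j' ∈ R) (hbj' : b < j')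
    (hlt : j' < cur) (hpred : ∀ p ∈ R, j' < p → cur ≤ p) (hs : StepI i b R f j j' g k) :
    StepIProps i b R f j' g k := by
  have hjj : j' < j := hlt.trans_le hI.le
  have hib := hF.le
  have hj := hI.mem
  have hadj := hI.adj
  have hmid : ∀ p ∈ R, j' < p → p < j → High b R (f p) := fun p hp h1 h2 =>
    hI.high p hp (hpred p hp h1) h2
  have hfj := hI.adj_lt hj' hbj'
  have hfj'' := hI.isMatch.lt j' hj'
  cases hs with
  | large h1 =>
    have hre : Rearr i R f (f ∘ Equiv.swap j j') := by
      refine .swap hI.isMatch hj hj' hfj (by omega) (by have := hadj.1; omega) ?_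
      intro _ p hp h2
      have := (hmid p hp (by omega) (by omega)).1
      omega
    have hv := comp_swap_apply f j j'
    refine ⟨⟨hre.isMatch, hre.ne_of_ne hI.ne, hj', hbj', le_rfl, ?_, ?_, ?_, ?_⟩, hre, ?_, ?_, ?_⟩
    · rw [hv]; simpa [hjj.ne] using hadj
    · intro p _ h2 h3; omega
    · intro p hp h2 h3
      rw [hv] at h3
      by_cases hpj : p < j
      · rw [if_neg hpj.ne, if_neg h2.ne'] at h3
        have := (hmid p hp h2 hpj).1; omega
      · exact ⟨j, hj, hjj, by omega, by rw [hv]; simpa using h1⟩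
    · intro p hp h2 h3 h4
      rw [hv, if_neg (by omega), if_neg (by omega)] at h3 h4
      exact ⟨j, hj, by omega, by rw [hv]; simpa using h1⟩
    · intro p _ h2
      rw [hv, if_neg (by omega), if_neg (by omega)]
    · intro p hp
      have n1 : ¬ High b R (f j) := hadj.not_high
      have n2 : ¬ High b R (f j') := fun h => by have := h.1; omega
      rw [hv]; split_ifs with e1 e2
      · subst e1; simp [n1, n2]
      · subst e2; simp [n1, n2]
      · rfl
    -- The large arc ending at `j'` crosses the arc at the pointer; the swap nests them and costs
    -- one crossing.
    · rw [if_pos h1, Equiv.swap_comm]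
      refine crossNum_swap_of_crossing hI.isMatch.inj hj' hj hjj ?_ hfj ?_
      · have := hadj.1; omega
      · intro p hp h2 h3
        exact Or.inr (hadj.lt_high (hmid p hp h2 h3))
  | adjoins h1 =>
    have n1 : ¬ f j' < i := by have := h1.1; omega
    refine ⟨⟨hI.isMatch, hI.ne, hj', hbj', le_rfl, h1, ?_, ?_, ?_⟩, .refl hI.isMatch,
      fun _ _ _ => rfl, fun _ _ => Iff.rfl, by simp [n1]⟩
    · intro p _ h2 h3; omega
    · intro p hp h2 h3
      rcases lt_trichotomy p j with h4 | h4 | h4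
      · have := (hmid p hp h2 h4).1; omega
      · subst h4; have := hadj.1; omega
      · obtain ⟨p', hp', h5, h6, h7⟩ := hI.first p hp h4 h3
        exact ⟨p', hp', by omega, h6, h7⟩
    · intro p hp h2; exact hI.low p hp (by omega)
  | high h1 =>
    have n1 : ¬ f j' < i := by have := h1.1; omega
    refine ⟨⟨hI.isMatch, hI.ne, hj, hbj', hjj.le, hadj, ?_, hI.first, ?_⟩, .refl hI.isMatch,
      fun _ _ _ => rfl, fun _ _ => Iff.rfl, by simp [n1]⟩
    · intro p hp h2 h3
      rcases eq_or_lt_of_le h2 with rfl | h2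
      · exact h1
      · exact hmid p hp h2 h3
    · intro p hp h2; exact hI.low p hp (by omega)
  | @low m h1 h2 hm hjm h3 h4 =>
    have hv := comp_swap_apply f j j'
    have hjb := hadj.1
    have hre1 : Rearr i R f (f ∘ Equiv.swap j j') := by
      refine .swap hI.isMatch hj hj' hfj (by omega) (by omega) ?_
      intro h; omega
    have hw := comp_swap_apply (f ∘ Equiv.swap j j') j m
    have v1 : (f ∘ Equiv.swap j j') j = f j' := by simp
    have v2 : (f ∘ Equiv.swap j j') m = f m := by rw [hv, if_neg (by omega), if_neg (by omega)]
    have v3 : (f ∘ Equiv.swap j j') j' = f j := by simp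
    have hre2 : Rearr i R (f ∘ Equiv.swap j j') ((f ∘ Equiv.swap j j') ∘ Equiv.swap j m) := by
      refine .swap hre1.isMatch hj hm (by omega) (by omega) (by omega) ?_
      intro _ p hp h5
      have := h4 p hp (by omega) (by omega)
      rw [hv, if_neg (by omega), if_neg (by omega)]
      omega
    have hre := hre1.trans hre2
    have w1 : ((f ∘ Equiv.swap j j') ∘ Equiv.swap j m) j = f m := by rw [hw, if_pos rfl, v2]
    have w2 : ((f ∘ Equiv.swap j j') ∘ Equiv.swap j m) m = f j' := by
      rw [hw, if_neg (by omega), if_pos rfl, v1]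
    have w3 : ((f ∘ Equiv.swap j j') ∘ Equiv.swap j m) j' = f j := by
      rw [hw, if_neg (by omega), if_neg (by omega), v3]
    have w4 : ∀ p, p ≠ j → p ≠ j' → p ≠ m →
        ((f ∘ Equiv.swap j j') ∘ Equiv.swap j m) p = f p := by
      intro p n1 n2 n3
      rw [hw, if_neg n1, if_neg n3, hv, if_neg n1, if_neg n2]
    -- By `first`, an arc starting before `b` would be preceded by a large one, contradicting the
    -- choice of `m` as the nearest large arc.
    have hjm' : ∀ p ∈ R, j < p → p < m → b < f p := by
      intro p hp h5 h6
      by_contra h7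
      have h8 := hF.ne hI.isMatch hI.ne hp
      obtain ⟨p', hp', h9, h10, h11⟩ := hI.first p hp h5 (by omega)
      exact h4 p' hp' h9 (by omega) h11
    refine ⟨⟨hre.isMatch, hre.ne_of_ne hI.ne, hj', hbj', le_rfl, ?_, ?_, ?_, ?_⟩, hre, ?_, ?_, ?_⟩
    · rw [w3]; exact hadj
    · intro p _ h2 h3; omega
    · intro p hp h5 h6
      by_cases hpj : p < j
      · rw [w4 p (by omega) (by omega) (by omega)] at h6
        have := (hmid p hp h5 hpj).1; omega
      · exact ⟨j, hj, hjj, by omega, by rw [w1]; exact h3⟩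
    · intro p hp h5 h6 h7
      exact ⟨j, hj, by omega, by rw [w1]; exact h3⟩
    · intro p _ h5
      exact w4 p (by omega) (by omega) (by omega)
    · intro p hp
      have n1 : ¬ High b R (f j) := hadj.not_high
      have n2 : ¬ High b R (f j') := fun h => by have := h.1; omega
      have n3 : ¬ High b R (f m) := fun h => by have := h.1; omega
      by_cases e1 : p = j
      · subst e1; rw [w1]; simp [n1, n3]
      by_cases e2 : p = j'
      · subst e2; rw [w3]; simp [n1, n2]
      by_cases e3 : p = m
      · subst e3; rw [w2]; simp [n2, n3]
      rw [w4 p e1 e2 e3]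
    -- The swap of `j` and `j'` destroys one crossing and the swap of `j` and `m` creates one, so
    -- borrowing from a large arc keeps the balance.
    · rw [if_neg (by omega), crossNum_swap_of_nested hre1.isMatch.inj hj hm hjm (by omega) (by omega),
        Equiv.swap_comm]
      · refine crossNum_swap_of_crossing hI.isMatch.inj hj' hj hjj (by omega) hfj ?_
        intro p hp h5 h6
        exact Or.inr (hadj.lt_high (hmid p hp h5 h6))
      · intro p hp h5 h6
        rw [v1, hv, if_neg (by omega), if_neg (by omega)]
        have := hjm' p hp h5 h6
        omega

end

/-! ### Undoing one round of the first algorithm -/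

/-- To the right of `j`, the first arc that starts to the left of `b` is large. -/
def FirstLarge (i b : ℕ) (R : Finset ℕ) (g : ℕ → ℕ) (j : ℕ) : Prop :=
  ∀ p ∈ R, j < p → g p < b → ∃ p' ∈ R, j < p' ∧ p' ≤ p ∧ g p' < i

/-- To the right of `j`, the first arc that starts to the left of `b` ends at `m` and is small. -/
def FirstLow (i b : ℕ) (R : Finset ℕ) (g : ℕ → ℕ) (j m : ℕ) : Prop :=
  m ∈ R ∧ j < m ∧ i < g m ∧ g m < b ∧ ∀ p ∈ R, j < p → p < m → b < g p

theorem eqOn_comp_swap {R : Finset ℕ} {f g : ℕ → ℕ} {a b : ℕ} (ha : a ∈ R) (hb : b ∈ R)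
    (h : Set.EqOn f g R) : Set.EqOn (f ∘ Equiv.swap a b) (g ∘ Equiv.swap a b) R :=
  fun _ hp => h (swap_mem ha hb hp)

theorem eqOn_of_comp_swap {R : Finset ℕ} {f g : ℕ → ℕ} {a b : ℕ} (ha : a ∈ R) (hb : b ∈ R)
    (h : Set.EqOn (f ∘ Equiv.swap a b) (g ∘ Equiv.swap a b) R) : Set.EqOn f g R := by
  intro p hp
  simpa using h (swap_mem ha hb hp)

theorem comp_swap_comp_swap (f : ℕ → ℕ) (a b : ℕ) :
    (f ∘ Equiv.swap a b) ∘ Equiv.swap a b = f := by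
  ext p; simp

section

variable {i b : ℕ} {R : Finset ℕ} {f f' g g' h h' : ℕ → ℕ} {j j' k k' m m' cur : ℕ}

theorem FirstLarge.congr (h : FirstLarge i b R g j) (e : Set.EqOn g g' R) :
    FirstLarge i b R g' j := by
  intro p hp h1 h2
  obtain ⟨p', hp', h3, h4, h5⟩ := h p hp h1 (by rwa [e hp])
  exact ⟨p', hp', h3, h4, by rwa [← e hp']⟩

theorem FirstLow.congr (h : FirstLow i b R g j m) (e : Set.EqOn g g' R) :
    FirstLow i b R g' j m := by
  obtain ⟨h1, h2, h3, h4, h5⟩ := h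
  exact ⟨h1, h2, e h1 ▸ h3, e h1 ▸ h4, fun p hp h6 h7 => e hp ▸ h5 p hp h6 h7⟩

theorem FirstLarge.not_firstLow (h : FirstLarge i b R g j) (hib : i ≤ b) :
    ¬ FirstLow i b R g j m := by
  rintro ⟨h1, h2, h3, h4, h5⟩
  obtain ⟨p', hp', h6, h7, h8⟩ := h m h1 h2 h4
  rcases eq_or_lt_of_le h7 with rfl | h7
  · omega
  · have := h5 p' hp' h6 h7; omega

theorem FirstLow.unique (h : FirstLow i b R g j m) (h' : FirstLow i b R g j m') : m = m' := by
  obtain ⟨h1, h2, h3, h4, h5⟩ := h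
  obtain ⟨h1', h2', h3', h4', h5'⟩ := h'
  rcases lt_trichotomy m m' with h6 | h6 | h6
  · have := h5' m h1 h2 h6; omega
  · exact h6
  · have := h5 m' h1' h2' h6; omega

theorem FirstLarge.between (h : FirstLarge i b R g j) (hF : Frame i b R) (hg : IsMatch R g)
    (hne : ∀ p ∈ R, g p ≠ i) (h1 : ∀ p ∈ R, j < p → p < m → ¬ g p < i) :
    ∀ p ∈ R, j < p → p < m → b < g p := by
  intro p hp h5 h6
  by_contra h7
  have h8 := hF.ne hg hne hp
  obtain ⟨p', hp', h9, h10, h11⟩ := h p hp h5 (by omega)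
  exact h1 p' hp' h9 (by omega) h11

/-- The possible results of a round in which the first pointer moves. -/
theorem StepI.cases_moved (hI : InvI i b R f j cur) (hF : Frame i b R) (hlt : j' < cur)
    (hpred : ∀ p ∈ R, j' < p → cur ≤ p) (hs : StepI i b R f j j' g k) :
    (k = j ∧ g = f) ∨ (k = j' ∧ (∀ p ∈ R, j' < p → p < j → High b R (g p)) ∧ ¬ High b R (g j) ∧
      ((b < g j ∧ f = g) ∨
        (g j < i ∧ f = g ∘ Equiv.swap j j' ∧ FirstLarge i b R g j) ∨
        (g j < i ∧ ∃ m, FirstLow i b R g j m ∧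
          f = (g ∘ Equiv.swap j m) ∘ Equiv.swap j j'))) := by
  have hjj : j' < j := hlt.trans_le hI.le
  have hib := hF.le
  have hmid : ∀ p ∈ R, j' < p → p < j → High b R (f p) := fun p hp h1 h2 =>
    hI.high p hp (hpred p hp h1) h2
  cases hs with
  | large h1 =>
    have hv := comp_swap_apply f j j'
    refine Or.inr ⟨rfl, ?_, ?_, Or.inr (Or.inl ⟨?_, (comp_swap_comp_swap _ _ _).symm, ?_⟩)⟩
    · intro p hp h2 h3
      rw [hv, if_neg (by omega), if_neg (by omega)]
      exact hmid p hp h2 h3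
    · rw [hv, if_pos rfl]
      intro h; have := h.1; omega
    · rwa [hv, if_pos rfl]
    · intro p hp h2 h3
      rw [hv, if_neg (by omega), if_neg (by omega)] at h3
      obtain ⟨p', hp', h4, h5, h6⟩ := hI.first p hp h2 h3
      exact ⟨p', hp', h4, h5, by rwa [hv, if_neg (by omega), if_neg (by omega)]⟩
  | adjoins h1 =>
    exact Or.inr ⟨rfl, hmid, hI.adj.not_high, Or.inl ⟨hI.adj.1, rfl⟩⟩
  | high h1 => exact Or.inl ⟨rfl, rfl⟩
  | @low m h1 h2 hm hjm h3 h4 =>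
    have hv := comp_swap_apply f j j'
    have hw := comp_swap_apply (f ∘ Equiv.swap j j') j m
    have v2 : (f ∘ Equiv.swap j j') m = f m := by rw [hv, if_neg (by omega), if_neg (by omega)]
    have hbet := FirstLarge.between hI.first hF hI.isMatch hI.ne h4
    have wj : ((f ∘ Equiv.swap j j') ∘ Equiv.swap j m) j = f m := by rw [hw, if_pos rfl, v2]
    have wm : ((f ∘ Equiv.swap j j') ∘ Equiv.swap j m) m = f j' := by
      rw [hw, if_neg (by omega), if_pos rfl, hv, if_pos rfl]
    have w4 : ∀ p, p ≠ j → p ≠ j' → p ≠ m →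
        ((f ∘ Equiv.swap j j') ∘ Equiv.swap j m) p = f p := by
      intro p n1 n2 n3
      rw [hw, if_neg n1, if_neg n3, hv, if_neg n1, if_neg n2]
    refine Or.inr ⟨rfl, ?_, ?_, Or.inr (Or.inr ⟨by rwa [wj], m, ⟨hm, hjm, ?_, ?_, ?_⟩, ?_⟩)⟩
    · intro p hp h5 h6
      rw [w4 p (by omega) (by omega) (by omega)]
      exact hmid p hp h5 h6
    · rw [wj]; intro h; have := h.1; omega
    · rwa [wm]
    · rwa [wm]
    · intro p hp h5 h6
      rw [w4 p (by omega) (by omega) (by omega)]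
      exact hbet p hp h5 h6
    · rw [comp_swap_comp_swap, comp_swap_comp_swap]

/-- Whether the pointer moved is seen from `k`, being `x` or larger than `x`. In the moved case its
old position is recovered first. The arc left there is large exactly for the two swapping rules, and
these differ in whether the next arc starting before `b` is large or small. -/
theorem StepI.injective {x : ℕ} (hI : InvI i b R f j cur) (hI' : InvI i b R f' j' cur)
    (hF : Frame i b R) (hx : x ∈ R) (hlt : x < cur) (hpred : ∀ p ∈ R, x < p → cur ≤ p)
    (hs : StepI i b R f j x g k) (hs' : StepI i b R f' j' x g' k) (e : Set.EqOn g g' R) :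
    Set.EqOn f f' R ∧ j = j' := by
  have hjx : x < j := hlt.trans_le hI.le
  have hjx' : x < j' := hlt.trans_le hI'.le
  have hib := hF.le
  rcases hs.cases_moved hI hF hlt hpred with ⟨h1, h2⟩ | ⟨h1, h2, h3, h4⟩ <;>
  rcases hs'.cases_moved hI' hF hlt hpred with ⟨h1', h2'⟩ | ⟨h1', h2', h3', h4'⟩
  · subst h2 h2'
    exact ⟨e, by omega⟩
  · omega
  · omega
  have hjj : j = j' := by
    rcases lt_trichotomy j j' with h | h | h
    · exact absurd (e hI.mem ▸ h2' j hI.mem hjx h) h3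
    · exact h
    · exact absurd ((e hI'.mem).symm ▸ h2 j' hI'.mem hjx' h) h3'
  subst hjj
  refine ⟨?_, rfl⟩
  have ej := e hI.mem
  rcases h4 with ⟨h5, h6⟩ | ⟨h5, h6, h7⟩ | ⟨h5, m, h7, h6⟩ <;>
  rcases h4' with ⟨h5', h6'⟩ | ⟨h5', h6', h7'⟩ | ⟨h5', m', h7', h6'⟩
  · rwa [h6, h6']
  · omega
  · omega
  · omega
  · rw [h6, h6']; exact eqOn_comp_swap hI.mem hx e
  · exact absurd h7' ((h7.congr e).not_firstLow hib)
  · omega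
  · exact absurd (h7.congr e) (h7'.not_firstLow hib)
  · obtain rfl := (h7.congr e).unique h7'
    rw [h6, h6']
    exact eqOn_comp_swap hI.mem hx (eqOn_comp_swap hI.mem h7.1 e)

end

/-! ### Runs of the first algorithm -/

/-- `l` lists the elements of `R` strictly between `b` and `cur` in decreasing order. -/
def Desc (R : Finset ℕ) (b cur : ℕ) (l : List ℕ) : Prop :=
  l.Pairwise (· > ·) ∧ ∀ p, p ∈ l ↔ p ∈ R ∧ b < p ∧ p < cur

theorem Desc.of_cons {R : Finset ℕ} {b cur x : ℕ} {l : List ℕ} (h : Desc R b cur (x :: l)) :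
    x ∈ R ∧ b < x ∧ x < cur ∧ (∀ p ∈ R, x < p → cur ≤ p) ∧ Desc R b x l := by
  obtain ⟨h1, h2⟩ := h
  rw [List.pairwise_cons] at h1
  obtain ⟨h3, h4, h5⟩ := (h2 x).1 (by simp)
  refine ⟨h3, h4, h5, ?_, h1.2, ?_⟩
  · intro p hp hxp
    by_contra hlt
    rcases List.mem_cons.1 ((h2 p).2 ⟨hp, by omega, by omega⟩) with h6 | h6
    · omega
    · have := h1.1 p h6; omega
  · intro p
    constructor
    · intro hp
      obtain ⟨h6, h7, h8⟩ := (h2 p).1 (by simp [hp])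
      exact ⟨h6, h7, h1.1 p hp⟩
    · rintro ⟨h6, h7, h8⟩
      rcases List.mem_cons.1 ((h2 p).2 ⟨h6, h7, by omega⟩) with h9 | h9
      · omega
      · exact h9

theorem desc_sort (R : Finset ℕ) (b cur : ℕ) :
    Desc R b cur ((R.filter fun p => b < p ∧ p < cur).sort (· ≥ ·)) :=
  ⟨Finset.sortedGT_sort _ |>.pairwise, fun p => by simp⟩

theorem Desc.unique {R : Finset ℕ} {b cur : ℕ} {l l' : List ℕ} (h : Desc R b cur l)
    (h' : Desc R b cur l') : l = l' := by
  have hn : l.Nodup := h.1.imp (fun h => ne_of_gt h)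
  have hn' : l'.Nodup := h'.1.imp (fun h => ne_of_gt h)
  have hp : l.Perm l' := (List.perm_ext_iff_of_nodup hn hn').2 fun p => by rw [h.2, h'.2]
  exact hp.eq_of_pairwise (fun a b _ _ h1 h2 => by omega) h.1 h'.1

theorem Desc.countP {R : Finset ℕ} {b cur : ℕ} {l : List ℕ} (h : Desc R b cur l) (P : ℕ → Prop)
    [DecidablePred P] :
    l.countP (fun p => decide (P p)) = (R.filter fun p => (b < p ∧ p < cur) ∧ P p).card := by
  have hn : l.Nodup := h.1.imp (fun h => ne_of_gt h)
  rw [List.countP_eq_length_filter, ← List.toFinset_card_of_nodup (hn.filter _)]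
  congr 1
  ext p
  simp [h.2, and_assoc]

/-- What a run of the first algorithm does. -/
structure RunIProps (i b : ℕ) (R : Finset ℕ) (f : ℕ → ℕ) (l : List ℕ) (g : ℕ → ℕ) (k : ℕ) :
    Prop where
  inv : ∃ cur, (∀ p ∈ R, b < p → cur ≤ p) ∧ InvI i b R g k cur
  rearr : Rearr i R f g
  eq_of_le : ∀ p ∈ R, p ≤ b → g p = f p
  high_iff : ∀ p ∈ R, High b R (g p) ↔ High b R (f p)
  cross : crossNum R f = crossNum R g + l.countP (fun p => decide (f p < i))

section

variable {i b : ℕ} {R : Finset ℕ} {f f' g g' : ℕ → ℕ} {j j' k k' cur : ℕ} {l : List ℕ}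

theorem exists_runI (hF : Frame i b R) (hI : InvI i b R f j cur) (hd : Desc R b cur l) :
    ∃ g k, RunI i b R f j l g k ∧ l.foldl (stepI i) (mkArcs R f, j) = (mkArcs R g, k) := by
  induction l generalizing f j cur with
  | nil => exact ⟨f, j, .nil, rfl⟩
  | cons x l ih =>
    obtain ⟨h1, h2, h3, h4, h5⟩ := hd.of_cons
    obtain ⟨g, k, hs, e⟩ := exists_stepI hI hF h1 h3 h4
    obtain ⟨h, m, hr, e'⟩ := ih (hs.props hI hF h1 h2 h3 h4).inv h5
    exact ⟨h, m, .cons hs hr, by rw [List.foldl_cons, e, e']⟩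

theorem RunI.props (hF : Frame i b R) (hI : InvI i b R f j cur)
    (hd : Desc R b cur l) (hr : RunI i b R f j l g k) : RunIProps i b R f l g k := by
  induction hr generalizing cur with
  | @nil f j =>
    refine ⟨⟨cur, fun p hp h => ?_, hI⟩, .refl hI.isMatch, fun _ _ _ => rfl, fun _ _ => Iff.rfl,
      by simp⟩
    by_contra h1
    have := (hd.2 p).2 ⟨hp, h, by omega⟩
    simp at this
  | @cons f g h j x k m l hs hr ih =>
    obtain ⟨h1, h2, h3, h4, h5⟩ := hd.of_cons
    have hp := hs.props hI hF h1 h2 h3 h4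
    obtain ⟨i1, i2, i3, i4, i5⟩ := ih hp.inv h5
    refine ⟨i1, hp.rearr.trans i2, fun p hpR hpb => ?_, fun p hpR => ?_, ?_⟩
    · rw [i3 p hpR hpb, hp.eq_of_lt p hpR (by omega)]
    · rw [i4 p hpR, hp.high_iff p hpR]
    · have : l.countP (fun p => decide (g p < i)) = l.countP (fun p => decide (f p < i)) := by
        refine List.countP_congr fun p hpl => ?_
        obtain ⟨h6, h7, h8⟩ := (h5.2 p).1 hpl
        rw [hp.eq_of_lt p h6 h8]
      rw [hp.cross, i5, this, List.countP_cons]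
      simp only [decide_eq_true_eq]
      omega

theorem RunI.injective (hF : Frame i b R) (hI : InvI i b R f j cur) (hI' : InvI i b R f' j' cur)
    (hd : Desc R b cur l) (hr : RunI i b R f j l g k) (hr' : RunI i b R f' j' l g' k)
    (e : Set.EqOn g g' R) : Set.EqOn f f' R ∧ j = j' := by
  induction hr generalizing cur f' j' with
  | nil => cases hr'; exact ⟨e, rfl⟩
  | cons hs hr ih =>
    cases hr' with
    | cons hs' hr' =>
      obtain ⟨h1, h2, h3, h4, h5⟩ := hd.of_cons
      obtain ⟨e1, rfl⟩ := ih (hs.props hI hF h1 h2 h3 h4).inv (hs'.props hI' hF h1 h2 h3 h4).inv h5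
        hr' e
      exact hs.injective hI hI' hF h1 h3 h4 hs' e1

/-- The pointer ends at the first right-hand endpoint to the right of `b`. -/
theorem InvI.pointer_le (hI : InvI i b R g k cur) (hcur : ∀ p ∈ R, b < p → cur ≤ p) :
    ∀ p ∈ R, b < p → k ≤ p := by
  intro p
  induction p using Nat.strong_induction_on with
  | _ p ih =>
    intro hp hbp
    by_contra hpk
    -- An arc ending between `b` and the pointer is high, which produces a still smaller right-hand
    -- endpoint after `b`; this cannot go on forever.
    obtain ⟨_, r, hr, h1, h2⟩ := hI.high p hp (hcur p hp hbp) (by omega)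
    have h3 := hI.isMatch.lt p hp
    have := ih r (by omega) hr h1
    omega

/-- A run may be started further to the right if only arcs starting after `b` are added. -/
theorem RunI.extend {q m : ℕ} {t : List ℕ} (hq : Adjoins b R (f q))
    (ht : ∀ p ∈ t, b < f p) (hr : RunI i b R f q l g k) : RunI i b R f m (t ++ q :: l) g k := by
  induction t generalizing m with
  | nil => exact .cons (.adjoins hq) hr
  | cons x t ih =>
    rcases adjoins_or_high (R := R) (ht x (by simp)) with h | h
    · exact .cons (.adjoins h) (ih fun p hp => ht p (by simp [hp]))
    · exact .cons (.high h) (ih fun p hp => ht p (by simp [hp]))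

end

/-! ### The second algorithm -/

/-- The rounds of the second algorithm along a list of vertices, for functions. -/
inductive RunII (i : ℕ) : (ℕ → ℕ) → ℕ → List ℕ → (ℕ → ℕ) → Prop
  | nil {f : ℕ → ℕ} {j : ℕ} : RunII i f j [] f
  | large {f g : ℕ → ℕ} {j j' : ℕ} {l : List ℕ} : f j' < i → RunII i f j' l g →
      RunII i f j (j' :: l) g
  | low {f g : ℕ → ℕ} {j j' : ℕ} {l : List ℕ} : i < f j' →
      RunII i (f ∘ Equiv.swap j j') j' l g → RunII i f j (j' :: l) g

/-- The pre-processing of the second algorithm at the vertex `b`, for functions. -/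
def Borrow (i b : ℕ) (R : Finset ℕ) (g h : ℕ → ℕ) : Prop :=
  (g b < i ∧ h = g) ∨ (i < g b ∧ ∃ m ∈ R, b < m ∧ g m < i ∧
    (∀ p ∈ R, b < p → p < m → ¬ g p < i) ∧ h = g ∘ Equiv.swap b m)

/-- The second algorithm on the right-hand endpoints between `i` and `b` (inclusive). -/
def RunTail (i b : ℕ) (R : Finset ℕ) (g a : ℕ → ℕ) : Prop :=
  (b = i ∧ a = g) ∨ (i < b ∧ b ∈ R ∧ ∃ h l, Desc R i b l ∧ Borrow i b R g h ∧ RunII i h b l a)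

/-- What a run of the second algorithm does. -/
structure RunIIProps (i : ℕ) (R : Finset ℕ) (f : ℕ → ℕ) (j : ℕ) (l : List ℕ) (g : ℕ → ℕ) :
    Prop where
  rearr : Rearr i R f g
  eq_of_gt : ∀ p ∈ R, j < p → g p = f p
  long : ∀ p ∈ R, i < p → p ≤ j → g p < i ∨ ∃ r ∈ R, g p < r ∧ r < p
  cross : crossNum R g = crossNum R f + l.countP (fun p => decide (i < f p))

section

variable {i b : ℕ} {R : Finset ℕ} {f f' g g' a a' : ℕ → ℕ} {j j' k cur : ℕ} {l : List ℕ}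

/-- Here `x` is the predecessor of `j` in `R`, so no arc ends strictly between them and the order of
the large arcs cannot be disturbed. -/
theorem rearr_swap_pred {x : ℕ} (hf : IsMatch R f) (hj : j ∈ R) (hlj : f j < i)
    (hx : x ∈ R) (hix : i < x) (hxj : x < j) (hpred : ∀ p ∈ R, x < p → j ≤ p) (hl : i < f x) :
    Rearr i R f (f ∘ Equiv.swap j x) := by
  rw [Equiv.swap_comm]
  have := hf.lt x hx
  refine .swap hf hx hj (by omega) (by omega) hl.le ?_
  intro _ p hp h6
  have := hpred p hp
  omega

theorem exists_runII (hf : IsMatch R f) (hne : ∀ p ∈ R, f p ≠ i) (hj : j ∈ R) (hlj : f j < i)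
    (hd : Desc R i j l) :
    ∃ g, RunII i f j l g ∧ (l.foldl (stepII i) (mkArcs R f, j)).1 = mkArcs R g := by
  induction l generalizing f j with
  | nil => exact ⟨f, .nil, rfl⟩
  | cons x l ih =>
    obtain ⟨h1, h2, h3, h4, h5⟩ := hd.of_cons
    rcases lt_or_gt_of_ne (hne x h1) with hx | hx
    · obtain ⟨g, hr, e⟩ := ih hf hne h1 hx h5
      exact ⟨g, .large hx hr, by simpa [stepII, h1, hx] using e⟩
    · have hre := rearr_swap_pred hf hj hlj h1 h2 h3 h4 hx
      obtain ⟨g, hr, e⟩ := ih hre.isMatch (hre.ne_of_ne hne) h1 (by simpa using hlj) h5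
      exact ⟨g, .low hx hr, by
        simpa [stepII, h1, hx.not_gt, swapArcs_mkArcs hj h1 h3.ne'] using e⟩

theorem RunII.props (hf : IsMatch R f) (hj : j ∈ R) (hlj : f j < i) (hd : Desc R i j l)
    (hr : RunII i f j l g) : RunIIProps i R f j l g := by
  induction hr with
  | @nil f j =>
    refine ⟨.refl hf, fun _ _ _ => rfl, fun p hp h1 h2 => Or.inl ?_, by simp⟩
    rcases eq_or_lt_of_le h2 with rfl | h2
    · exact hlj
    · simpa using (hd.2 p).2 ⟨hp, h1, h2⟩
  | @large f g j x l hx hr ih =>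
    obtain ⟨h1, h2, h3, h4, h5⟩ := hd.of_cons
    obtain ⟨i1, i2, i3, i4⟩ := ih hf h1 hx h5
    refine ⟨i1, fun p hp h => i2 p hp (by omega), fun p hp h6 h7 => ?_, ?_⟩
    · rcases le_or_gt p x with h8 | h8
      · exact i3 p hp h6 h8
      · have : p = j := by have := h4 p hp h8; omega
        subst this
        exact Or.inl (by rwa [i2 p hp h8])
    · rw [i4, List.countP_cons]
      simp [hx.not_gt]
  | @low f g j x l hx hr ih =>
    obtain ⟨h1, h2, h3, h4, h5⟩ := hd.of_cons
    have hre := rearr_swap_pred hf hj hlj h1 h2 h3 h4 hx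
    have hv := comp_swap_apply f j x
    obtain ⟨i1, i2, i3, i4⟩ := ih hre.isMatch h1 (by simpa using hlj) h5
    have hfx := hf.lt x h1
    refine ⟨hre.trans i1, fun p hp h => ?_, fun p hp h6 h7 => ?_, ?_⟩
    · rw [i2 p hp (by omega), hv, if_neg (by omega), if_neg (by omega)]
    · rcases le_or_gt p x with h8 | h8
      · exact i3 p hp h6 h8
      · have : p = j := by have := h4 p hp h8; omega
        subst this
        exact Or.inr ⟨x, h1, by rwa [i2 p hp h8, hv, if_pos rfl], h3⟩
    · have e : l.countP (fun p => decide (i < (f ∘ Equiv.swap j x) p)) =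
          l.countP (fun p => decide (i < f p)) := by
        refine List.countP_congr fun p hpl => ?_
        obtain ⟨h6, h7, h8⟩ := (h5.2 p).1 hpl
        rw [hv, if_neg (by omega), if_neg (by omega)]
      rw [i4, e, List.countP_cons, Equiv.swap_comm,
        crossNum_swap_of_nested hf.inj h1 hj h3 (by omega) hfx]
      · simp [hx]; omega
      · intro p hp h6 h7
        have := h4 p hp h6
        omega

/-- The arc at the pointer is always large. A round leaves at `j` a large arc if it did nothing and
a small one if it swapped, and later rounds do not touch `j`; so the result shows which rule was
used. -/
theorem RunII.injective (hf : IsMatch R f) (hf' : IsMatch R f') (hj : j ∈ R) (hlj : f j < i)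
    (hlj' : f' j < i) (hd : Desc R i j l) (hr : RunII i f j l g) (hr' : RunII i f' j l g')
    (e : Set.EqOn g g' R) : Set.EqOn f f' R := by
  induction hr generalizing f' with
  | nil => cases hr'; exact e
  | @large f g j x l hx hr ih =>
    obtain ⟨h1, h2, h3, h4, h5⟩ := hd.of_cons
    cases hr' with
    | large hx' hr' => exact ih hf hf' h1 hx hx' h5 hr' e
    | low hx' hr' =>
      have hre' := rearr_swap_pred hf' hj hlj' h1 h2 h3 h4 hx'
      have := ih hf hre'.isMatch h1 hx (by simpa using hlj') h5 hr' e hj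
      simp at this
      omega
  | @low f g j x l hx hr ih =>
    obtain ⟨h1, h2, h3, h4, h5⟩ := hd.of_cons
    have hre := rearr_swap_pred hf hj hlj h1 h2 h3 h4 hx
    cases hr' with
    | large hx' hr' =>
      have := ih hre.isMatch hf' h1 (by simpa using hlj) hx' h5 hr' e hj
      simp at this
      omega
    | low hx' hr' =>
      have hre' := rearr_swap_pred hf' hj hlj' h1 h2 h3 h4 hx'
      exact eqOn_of_comp_swap hj h1
        (ih hre.isMatch hre'.isMatch h1 (by simpa using hlj) (by simpa using hlj') h5 hr' e)

/-- The properties of the result of the first algorithm that the second one needs. -/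
structure Ready (i b : ℕ) (R : Finset ℕ) (g : ℕ → ℕ) : Prop where
  isMatch : IsMatch R g
  ne : ∀ p ∈ R, g p ≠ i
  first : FirstLarge i b R g b
  large : b ∈ R → i < g b → ∃ p ∈ R, b < p ∧ g p < i
  next : ∀ c ∈ R, b < c → (∀ r ∈ R, b < r → c ≤ r) → b < g c

theorem exists_borrow (hg : Ready i b R g) (hb : b ∈ R) :
    ∃ h, Borrow i b R g h ∧ borrow i (mkArcs R g) b = mkArcs R h := by
  rcases lt_or_gt_of_ne (hg.ne b hb) with h1 | h1
  · exact ⟨g, Or.inl ⟨h1, rfl⟩, by simp [borrow, hb, h1.not_gt]⟩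
  · obtain ⟨p, hp, h2, h3⟩ := hg.large hb h1
    have hne : (largeEndsAfter i (mkArcs R g) b).Nonempty := by
      rw [largeEndsAfter_mkArcs]
      exact ⟨p, by simp [hp, h2, h3]⟩
    obtain ⟨k, hk⟩ : ∃ k, k = (largeEndsAfter i (mkArcs R g) b).min' hne := ⟨_, rfl⟩
    have hk1 : k ∈ R ∧ g k < i ∧ b < k := by
      have := Finset.min'_mem _ hne
      rw [← hk, largeEndsAfter_mkArcs] at this
      simpa using this
    have hk2 : ∀ p ∈ R, b < p → p < k → ¬ g p < i := by
      intro p hp hjp hpk hpi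
      have := Finset.min'_le (largeEndsAfter i (mkArcs R g) b) p
        (by rw [largeEndsAfter_mkArcs]; simp [hp, hpi, hjp])
      omega
    refine ⟨_, Or.inr ⟨h1, k, hk1.1, hk1.2.2, hk1.2.1, hk2, rfl⟩, ?_⟩
    rw [borrow, leftOf_mkArcs hb, if_pos h1, dif_pos hne, ← hk,
      swapArcs_mkArcs hb hk1.1 hk1.2.2.ne]

/-- What the pre-processing does. -/
structure BorrowProps (i b : ℕ) (R : Finset ℕ) (g h : ℕ → ℕ) : Prop where
  rearr : Rearr i R g h
  large : h b < i
  eq_of_lt : ∀ p ∈ R, p < b → h p = g p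
  lt_iff : ∀ p ∈ R, b < p → (b < h p ↔ b < g p)
  cross : crossNum R h = crossNum R g + if i < g b then 1 else 0
  kind : (h = g ∧ FirstLarge i b R h b) ∨
    ∃ m, FirstLow i b R h b m ∧ g = h ∘ Equiv.swap b m

theorem Borrow.props (hF : Frame i b R) (hg : Ready i b R g) (hb : b ∈ R)
    (hbo : Borrow i b R g h) : BorrowProps i b R g h := by
  have hib := hF.le
  rcases hbo with ⟨h1, rfl⟩ | ⟨h1, m, hm, h2, h3, h4, rfl⟩
  · exact ⟨.refl hg.isMatch, h1, fun _ _ _ => rfl, fun _ _ _ => Iff.rfl, by simp [h1.not_gt],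
      Or.inl ⟨rfl, hg.first⟩⟩
  · have hbet := hg.first.between hF hg.isMatch hg.ne h4
    have hlt := hg.isMatch.lt b hb
    have hv := comp_swap_apply g b m
    refine ⟨.swap hg.isMatch hb hm (by omega) (by omega) h1.le ?_, by simpa using h3, ?_, ?_, ?_,
      Or.inr ⟨m, ⟨hm, h2, by simpa using h1, by simpa using hlt, ?_⟩,
        (comp_swap_comp_swap _ _ _).symm⟩⟩
    · intro _ p hp h5
      have := h4 p hp
      omega
    · intro p _ h5
      rw [hv, if_neg (by omega), if_neg (by omega)]
    · intro p _ h5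
      rw [hv, if_neg (by omega)]
      split_ifs with h6
      · subst h6; omega
      · rfl
    -- The borrowed large arc contains the small arc at `b`; the swap makes the two cross, as a
    -- round of the second algorithm would.
    · rw [if_pos h1]
      refine crossNum_swap_of_nested hg.isMatch.inj hb hm h2 (by omega) hlt ?_
      intro p hp h5 h6
      have := hbet p hp h5 h6
      omega
    · intro p hp h5 h6
      rw [hv, if_neg (by omega), if_neg (by omega)]
      exact hbet p hp h5 h6

/-- What the second algorithm does. -/
structure RunTailProps (i b : ℕ) (R : Finset ℕ) (g a : ℕ → ℕ) : Prop where
  rearr : Rearr i R g a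
  lt_iff : ∀ p ∈ R, b < p → (b < a p ↔ b < g p)
  long : ∀ p ∈ R, i < p → p ≤ b → a p < i ∨ ∃ r ∈ R, a p < r ∧ r < p
  cross : crossNum R a = crossNum R g + (R.filter fun p => (i < p ∧ p ≤ b) ∧ i < g p).card

theorem RunTail.props (hF : Frame i b R) (hg : Ready i b R g) (ht : RunTail i b R g a) :
    RunTailProps i b R g a := by
  rcases ht with ⟨rfl, rfl⟩ | ⟨hib, hb, h, l, hd, hbo, hr⟩
  · refine ⟨.refl hg.isMatch, fun _ _ _ => Iff.rfl, fun p _ h1 h2 => by omega, ?_⟩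
    rw [Finset.filter_false_of_mem, Finset.card_empty, add_zero]
    intro p _; omega
  · have hbp := hbo.props hF hg hb
    have hrp := hr.props hbp.rearr.isMatch hb hbp.large hd
    refine ⟨hbp.rearr.trans hrp.rearr, fun p hp h1 => ?_, hrp.long, ?_⟩
    · rw [hrp.eq_of_gt p hp h1, hbp.lt_iff p hp h1]
    · have e1 : l.countP (fun p => decide (i < h p)) = l.countP (fun p => decide (i < g p)) := by
        refine List.countP_congr fun p hpl => ?_
        obtain ⟨h6, h7, h8⟩ := (hd.2 p).1 hpl
        rw [hbp.eq_of_lt p h6 h8]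
      rw [hrp.cross, hbp.cross, e1, hd.countP fun p => i < g p]
      have e2 : (R.filter fun p => (i < p ∧ p ≤ b) ∧ i < g p) =
          (R.filter fun p => (i < p ∧ p < b) ∧ i < g p) ∪ (R.filter fun p => p = b ∧ i < g p) := by
        ext p
        simp only [Finset.mem_filter, Finset.mem_union]
        constructor
        · rintro ⟨h1, ⟨h2, h3⟩, h4⟩
          rcases eq_or_lt_of_le h3 with h3 | h3 <;> tauto
        · rintro (⟨h1, ⟨h2, h3⟩, h4⟩ | ⟨h1, rfl, h4⟩)
          · exact ⟨h1, ⟨h2, h3.le⟩, h4⟩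
          · exact ⟨h1, ⟨hib, le_rfl⟩, h4⟩
      have e3 : (R.filter fun p => p = b ∧ i < g p).card = if i < g b then 1 else 0 := by
        split_ifs with h1
        · rw [Finset.card_eq_one]
          refine ⟨b, ?_⟩
          ext p
          simp only [Finset.mem_filter, Finset.mem_singleton]
          constructor
          · tauto
          · rintro rfl; exact ⟨hb, rfl, h1⟩
        · rw [Finset.filter_false_of_mem, Finset.card_empty]
          rintro p _ ⟨rfl, h2⟩; exact h1 h2
      rw [e2, Finset.card_union_of_disjoint, e3]
      · ring
      · rw [Finset.disjoint_filter]
        intro p _ h1 h2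
        omega

/-- After the rounds are undone, borrowing has taken place exactly when the first arc beyond `b`
that starts before `b` is small, and that arc marks the place `m` of the swap. -/
theorem RunTail.injective (hF : Frame i b R) (hg : Ready i b R g) (hg' : Ready i b R g')
    (ht : RunTail i b R g a) (ht' : RunTail i b R g' a') (e : Set.EqOn a a' R) :
    Set.EqOn g g' R := by
  rcases ht with ⟨h1, rfl⟩ | ⟨hib, hb, h, l, hd, hbo, hr⟩ <;>
  rcases ht' with ⟨h1', rfl⟩ | ⟨hib', hb', h', l', hd', hbo', hr'⟩
  · exact e
  · omega
  · omega
  · obtain rfl := hd.unique hd'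
    have hp := hbo.props hF hg hb
    have hp' := hbo'.props hF hg' hb
    have e1 := hr.injective hp.rearr.isMatch hp'.rearr.isMatch hb hp.large hp'.large hd hr' e
    rcases hp.kind with ⟨h2, h3⟩ | ⟨m, h2, h3⟩ <;> rcases hp'.kind with ⟨h2', h3'⟩ | ⟨m', h2', h3'⟩
    · rwa [← h2, ← h2']
    · exact absurd h2' ((h3.congr e1).not_firstLow hF.le)
    · exact absurd (h2.congr e1) (h3'.not_firstLow hF.le)
    · obtain rfl := (h2.congr e1).unique h2'
      rw [h3, h3']
      exact eqOn_comp_swap hb h2.1 e1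

/-! ### Both algorithms together -/

/-- The situation in which the first algorithm acts: `q` is the right-hand endpoint of the critical
small arc. -/
structure Critical (i b : ℕ) (R : Finset ℕ) (f : ℕ → ℕ) (q : ℕ) : Prop where
  mem : q ∈ R
  lt : b < q
  adj : Adjoins b R (f q)
  after : ∀ p ∈ R, q < p → b < f p
  large : ∃ p ∈ R, b < p ∧ f p < i ∧ ∀ p' ∈ R, p < p' → b < f p'

theorem Critical.inv (hc : Critical i b R f j) (hf : IsMatch R f) (hne : ∀ p ∈ R, f p ≠ i) :
    InvI i b R f j j where
  isMatch := hf
  ne := hne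
  mem := hc.mem
  b_lt := hc.lt
  le := le_rfl
  adj := hc.adj
  high p _ h1 h2 := by omega
  first p hp h1 h2 := by have := hc.after p hp h1; omega
  -- All arcs ending after the critical large arc start after `b`, so a low arc ends to its left.
  low p hp h1 h2 h3 := by
    obtain ⟨m, hm, h4, h5, h6⟩ := hc.large
    refine ⟨m, hm, ?_, h5⟩
    by_contra h7
    rcases eq_or_lt_of_le (not_lt.1 h7) with rfl | h8
    · omega
    · have := h6 p hp h8; omega

/-- The first algorithm on the right-hand endpoints to the right of `b`. -/
def RunHead (i b : ℕ) (R : Finset ℕ) (f g : ℕ → ℕ) : Prop :=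
  ((b = i ∨ f b < i) ∧ (∀ p ∈ R, b < p → b < f p) ∧ g = f) ∨
    ∃ q l k, Critical i b R f q ∧ Desc R b q l ∧ RunI i b R f q l g k

/-- What the first algorithm does. -/
structure RunHeadProps (i b : ℕ) (R : Finset ℕ) (f g : ℕ → ℕ) : Prop where
  ready : Ready i b R g
  rearr : Rearr i R f g
  eq_of_le : ∀ p ∈ R, p ≤ b → g p = f p
  cross : crossNum R f = crossNum R g + (R.filter fun p => b < p ∧ f p < i).card

/-- The left-hand endpoint of a large arc beyond `b` is still used, and the positions up to `b` are
unchanged, so it must again be matched beyond `b`. -/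
theorem exists_large_of_rearr (hf : IsMatch R f) (hre : Rearr i R f g)
    (heq : ∀ p ∈ R, p ≤ b → g p = f p) (hex : ∃ p ∈ R, b < p ∧ f p < i) :
    ∃ p ∈ R, b < p ∧ g p < i := by
  obtain ⟨p, hp, h1, h2⟩ := hex
  obtain ⟨q, hq, e⟩ := hre.exists_right hp
  refine ⟨q, hq, ?_, by omega⟩
  by_contra h3
  have h4 := heq q hq (by omega)
  have := hf.inj hq hp (h4.symm.trans e)
  omega

theorem RunHead.props (hF : Frame i b R) (hf : IsMatch R f) (hne : ∀ p ∈ R, f p ≠ i)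
    (hh : RunHead i b R f g) : RunHeadProps i b R f g := by
  have hib := hF.le
  rcases hh with ⟨h1, h2, rfl⟩ | ⟨q, l, k, hc, hd, hr⟩
  · refine ⟨⟨hf, hne, ?_, ?_, fun c hc hbc _ => h2 c hc hbc⟩, .refl hf, fun _ _ _ => rfl, ?_⟩
    · intro p hp h3 h4
      have := h2 p hp h3; omega
    · intro h3 h4
      rcases h1 with rfl | h1
      · exact absurd h3 hF.not_mem
      · omega
    · rw [Finset.filter_false_of_mem, Finset.card_empty, add_zero]
      rintro p hp ⟨h3, h4⟩
      have := h2 p hp h3; omega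
  · have hI := hc.inv hf hne
    have hrp := hr.props hF hI hd
    obtain ⟨cur, hcur, hI'⟩ := hrp.inv
    have hk := hI'.pointer_le hcur
    have hbk : b < k := hI'.b_lt.trans_le hI'.le
    refine ⟨⟨hI'.isMatch, hI'.ne, ?_, ?_, ?_⟩, hrp.rearr, hrp.eq_of_le, ?_⟩
    · intro p hp h1 h2
      have h3 : k ≠ p := by rintro rfl; have := hI'.adj.1; omega
      have h4 := hk p hp h1
      obtain ⟨p', hp', h5, h6, h7⟩ := hI'.first p hp (by omega) h2
      exact ⟨p', hp', by omega, h6, h7⟩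
    · intro _ _
      obtain ⟨m, hm, h4, h5, h6⟩ := hc.large
      exact exists_large_of_rearr hf hrp.rearr hrp.eq_of_le ⟨m, hm, h4, h5⟩
    · intro c hcR hbc hmin
      have : c = k := le_antisymm (hmin k hI'.mem hbk) (hk c hcR hbc)
      rw [this]; exact hI'.adj.1
    · rw [hrp.cross, hd.countP fun p => f p < i]
      congr 2
      ext p
      simp only [Finset.mem_filter]
      refine ⟨fun ⟨h1, ⟨h2, _⟩, h3⟩ => ⟨h1, h2, h3⟩, fun ⟨h1, h2, h3⟩ => ⟨h1, ⟨h2, ?_⟩, h3⟩⟩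
      by_contra h4
      rcases eq_or_lt_of_le (not_lt.1 h4) with rfl | h5
      · have := hc.adj.1; omega
      · have := hc.after p h1 h5; omega

/-- The run of the first algorithm may be started at the last arc that is not high. -/
theorem Critical.exists_last (hc : Critical i b R f j) (hd : Desc R b j l)
    (hr : RunI i b R f j l g k) :
    ∃ q l', Critical i b R f q ∧ Desc R b q l' ∧ RunI i b R f q l' g k ∧
      ∀ p ∈ R, q < p → High b R (f p) := by
  classical
  have hne : (R.filter fun p => b < p ∧ Adjoins b R (f p)).Nonempty :=
    ⟨j, by simp [hc.mem, hc.lt, hc.adj]⟩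
  obtain ⟨q, hq⟩ := Finset.exists_maximal hne
  obtain ⟨hqR, hbq, hqa⟩ : q ∈ R ∧ b < q ∧ Adjoins b R (f q) := by simpa using hq.1
  have hqmax : ∀ p ∈ R, b < p → Adjoins b R (f p) → p ≤ q := fun p hp h1 h2 =>
    not_lt.1 fun h => (hq.not_gt (by simp [hp, h1, h2])) h
  have hjq := hqmax j hc.mem hc.lt hc.adj
  have hc' : Critical i b R f q :=
    ⟨hqR, hbq, hqa, fun p hp h1 => hc.after p hp (by omega), hc.large⟩
  have hhigh : ∀ p ∈ R, q < p → High b R (f p) := by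
    intro p hp h1
    rcases adjoins_or_high (R := R) (hc'.after p hp h1) with h2 | h2
    · have := hqmax p hp (by omega) h2; omega
    · exact h2
  rcases eq_or_lt_of_le hjq with rfl | hlt
  · exact ⟨j, l, hc', hd, hr, hhigh⟩
  -- The list `t` contains the ends strictly between `j` and `q`. Their arcs start after `b`, so the
  -- additional rounds only move the pointer.
  · have hd1 := desc_sort R j q
    obtain ⟨t, ht⟩ : ∃ t, t = (R.filter fun p => j < p ∧ p < q).sort (· ≥ ·) := ⟨_, rfl⟩
    rw [← ht] at hd1
    refine ⟨q, t ++ j :: l, hc', ⟨?_, ?_⟩, hr.extend hc.adj ?_, hhigh⟩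
    · rw [List.pairwise_append, List.pairwise_cons]
      refine ⟨hd1.1, ⟨fun p hp => ((hd.2 p).1 hp).2.2, hd.1⟩, fun p hp p' hp' => ?_⟩
      have h1 := (hd1.2 p).1 hp
      rcases List.mem_cons.1 hp' with rfl | h2
      · exact h1.2.1
      · have := (hd.2 p').1 h2; omega
    · intro p
      rw [List.mem_append, List.mem_cons, hd1.2, hd.2]
      have h1 := hc.lt
      constructor
      · rintro (⟨h2, h3⟩ | rfl | ⟨h2, h3⟩)
        · exact ⟨h2, by omega⟩
        · exact ⟨hc.mem, by omega⟩
        · exact ⟨h2, by omega⟩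
      · rintro ⟨h2, h3⟩
        rcases lt_trichotomy p j with h4 | h4 | h4
        · exact Or.inr (Or.inr ⟨h2, by omega⟩)
        · exact Or.inr (Or.inl h4)
        · exact Or.inl ⟨h2, by omega⟩
    · intro p hp
      obtain ⟨h1, h2, h3⟩ := (hd1.2 p).1 hp
      exact hc.after p h1 h2

/-- The idle case is the one with no large arc ending beyond `b`, and this can be seen in the
result. Otherwise the start of the run is ambiguous, so both runs are started at the last arc that
is not high. The set of high positions is invariant, so this start is common to both runs; the
pointer always ends at the first endpoint after `b`. -/
theorem RunHead.injective (hF : Frame i b R) (hf : IsMatch R f) (hne : ∀ p ∈ R, f p ≠ i)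
    (hf' : IsMatch R f') (hne' : ∀ p ∈ R, f' p ≠ i) (hh : RunHead i b R f g)
    (hh' : RunHead i b R f' g') (e : Set.EqOn g g' R) : Set.EqOn f f' R := by
  have hib := hF.le
  have hcrit : ∀ {f g : ℕ → ℕ} {q k : ℕ} {l : List ℕ}, IsMatch R f → (∀ p ∈ R, f p ≠ i) →
      Critical i b R f q → Desc R b q l → RunI i b R f q l g k → ∃ p ∈ R, b < p ∧ g p < i := by
    intro f g q k l hf hne hc hd hr
    have hrp := hr.props hF (hc.inv hf hne) hd
    obtain ⟨m, hm, h4, h5, h6⟩ := hc.large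
    exact exists_large_of_rearr hf hrp.rearr hrp.eq_of_le ⟨m, hm, h4, h5⟩
  rcases hh with ⟨h1, h2, rfl⟩ | ⟨q, l, k, hc, hd, hr⟩ <;>
  rcases hh' with ⟨h1', h2', rfl⟩ | ⟨q', l', k', hc', hd', hr'⟩
  · exact e
  · obtain ⟨p, hp, h3, h4⟩ := hcrit hf' hne' hc' hd' hr'
    have := h2 p hp h3
    have := e hp
    omega
  · obtain ⟨p, hp, h3, h4⟩ := hcrit hf hne hc hd hr
    have := h2' p hp h3
    have := e hp
    omega
  · obtain ⟨q, l, hc, hd, hr, hh⟩ := hc.exists_last hd hr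
    obtain ⟨q', l', hc', hd', hr', hh'⟩ := hc'.exists_last hd' hr'
    have hrp := hr.props hF (hc.inv hf hne) hd
    have hrp' := hr'.props hF (hc'.inv hf' hne') hd'
    have hiff : ∀ p ∈ R, High b R (f p) ↔ High b R (f' p) := fun p hp => by
      rw [← hrp.high_iff p hp, ← hrp'.high_iff p hp, e hp]
    have hq : q = q' := by
      rcases lt_trichotomy q q' with h | h | h
      · exact absurd ((hiff q' hc'.mem).1 (hh q' hc'.mem h)) hc'.adj.not_high
      · exact h
      · exact absurd ((hiff q hc.mem).2 (hh' q hc.mem h)) hc.adj.not_high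
    subst hq
    obtain rfl := hd.unique hd'
    obtain ⟨cur, hcur, hI⟩ := hrp.inv
    obtain ⟨cur', hcur', hI'⟩ := hrp'.inv
    have hk : k = k' := le_antisymm
      (hI.pointer_le hcur k' hI'.mem (hI'.b_lt.trans_le hI'.le))
      (hI'.pointer_le hcur' k hI.mem (hI.b_lt.trans_le hI.le))
    subst hk
    exact (hr.injective hF (hc.inv hf hne) (hc'.inv hf' hne') hd hr' e).1

/-- The effect of both algorithms, where `b` is the last right-hand endpoint in the second region
(or `i` if that region is empty). -/
def Run (i b : ℕ) (R : Finset ℕ) (f a : ℕ → ℕ) : Prop :=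
  Frame i b R ∧ ∃ g, RunHead i b R f g ∧ RunTail i b R g a

theorem Run.rearr (hf : IsMatch R f) (hne : ∀ p ∈ R, f p ≠ i) (hr : Run i b R f a) :
    Rearr i R f a := by
  obtain ⟨hF, g, hh, ht⟩ := hr
  have hp := hh.props hF hf hne
  exact hp.rearr.trans (ht.props hF hp.ready).rearr

/-- The gain is the number of small arcs ending in `(i, b]`, the loss the number of large arcs
ending after `b`. Adding all large arcs ending after `i` turns this into the number of all ends in
`(i, b]`. -/
theorem Run.crossNum_add (hf : IsMatch R f) (hne : ∀ p ∈ R, f p ≠ i) (hr : Run i b R f a) :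
    crossNum R a + (R.filter fun p => i < p ∧ f p < i).card =
      crossNum R f + (R.filter fun p => i < p ∧ p ≤ b).card := by
  obtain ⟨hF, g, hh, ht⟩ := hr
  have hp := hh.props hF hf hne
  have hib := hF.le
  rw [(ht.props hF hp.ready).cross, hp.cross]
  have e1 : (R.filter fun p => (i < p ∧ p ≤ b) ∧ i < g p) =
      (R.filter fun p => i < p ∧ p ≤ b).filter fun p => ¬ f p < i := by
    rw [Finset.filter_filter]
    refine Finset.filter_congr fun p hpR => ?_
    constructor
    · rintro ⟨h1, h2⟩
      exact ⟨h1, by rw [← hp.eq_of_le p hpR h1.2]; omega⟩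
    · rintro ⟨h1, h2⟩
      have := hne p hpR
      exact ⟨h1, by rw [hp.eq_of_le p hpR h1.2]; omega⟩
  have e2 : (R.filter fun p => i < p ∧ f p < i).card =
      (R.filter fun p => b < p ∧ f p < i).card +
        ((R.filter fun p => i < p ∧ p ≤ b).filter fun p => f p < i).card := by
    rw [← Finset.card_union_of_disjoint]
    · congr 1
      ext p
      simp only [Finset.mem_filter, Finset.mem_union]
      constructor
      · rintro ⟨h1, h2, h3⟩
        rcases le_or_gt p b with h4 | h4 <;> tauto
      · rintro (⟨h1, h2, h3⟩ | ⟨⟨h1, h2, h3⟩, h4⟩)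
        · exact ⟨h1, by omega, h3⟩
        · exact ⟨h1, h2, h4⟩
    · rw [Finset.filter_filter, Finset.disjoint_filter]
      intro p _ h1 h2
      omega
  have e3 := Finset.card_filter_add_card_filter_not (s := R.filter fun p => i < p ∧ p ≤ b)
    (fun p => f p < i)
  rw [e1, e2]
  omega

/-- If `b < b'`, let `c` be the first right-hand endpoint after `b`. The run with bound `b` leaves
at `c` an arc starting after `b`, with no right-hand endpoint inside. The run with bound `b'` leaves
at `c` a large arc or one with such an endpoint. -/
theorem Run.bound_le {b' : ℕ} (hf : IsMatch R f) (hne : ∀ p ∈ R, f p ≠ i) (hf' : IsMatch R f')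
    (hne' : ∀ p ∈ R, f' p ≠ i) (hr : Run i b R f a) (hr' : Run i b' R f' a')
    (e : Set.EqOn a a' R) : b' ≤ b := by
  by_contra hlt
  obtain ⟨hF, g, hh, ht⟩ := hr
  obtain ⟨hF', g', hh', ht'⟩ := hr'
  have hp := hh.props hF hf hne
  have htp := ht.props hF hp.ready
  have htp' := ht'.props hF' (hh'.props hF' hf' hne').ready
  have hib := hF.le
  have hb' : b' ∈ R := by
    rcases hF'.mem with h | h
    · omega
    · exact h
  have hne : (R.filter fun p => b < p).Nonempty := ⟨b', by simp [hb']; omega⟩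
  obtain ⟨c, hc⟩ := Finset.exists_minimal hne
  obtain ⟨hcR, hbc⟩ : c ∈ R ∧ b < c := by simpa using hc.1
  have hmin : ∀ r ∈ R, b < r → c ≤ r := fun r hr h1 =>
    not_lt.1 fun h => hc.not_lt (by simp [hr, h1]) h
  have h1 := (htp.lt_iff c hcR hbc).2 (hp.ready.next c hcR hbc hmin)
  have h2 := e hcR
  rcases htp'.long c hcR (by omega) (hmin b' hb' (by omega)) with h3 | ⟨r, hr, h3, h4⟩
  · omega
  · have := hmin r hr (by omega)
    omega

theorem Run.injective {b' : ℕ} (hf : IsMatch R f) (hne : ∀ p ∈ R, f p ≠ i) (hf' : IsMatch R f')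
    (hne' : ∀ p ∈ R, f' p ≠ i) (hr : Run i b R f a) (hr' : Run i b' R f' a')
    (e : Set.EqOn a a' R) : Set.EqOn f f' R := by
  obtain rfl : b = b' := le_antisymm (hr'.bound_le hf' hne' hf hne hr e.symm)
    (hr.bound_le hf hne hf' hne' hr' e)
  obtain ⟨hF, g, hh, ht⟩ := hr
  obtain ⟨-, g', hh', ht'⟩ := hr'
  have hp := hh.props hF hf hne
  have hp' := hh'.props hF hf' hne'
  exact hh.injective hF hf hne hf' hne' hh' (ht.injective hF hp.ready hp'.ready ht' e)

end

/-! ### The algorithms on the regions of a matching -/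

theorem sort_filter_le {R : Finset ℕ} {b q : ℕ} (hq : q ∈ R) (hbq : b < q) :
    (R.filter fun p => b < p ∧ p ≤ q).sort (· ≥ ·) =
      q :: (R.filter fun p => b < p ∧ p < q).sort (· ≥ ·) := by
  -- `Desc` refers to an open interval, so `q` is included by taking the bound `q + 1`.
  have h1 : Desc R b (q + 1) ((R.filter fun p => b < p ∧ p ≤ q).sort (· ≥ ·)) :=
    ⟨Finset.sortedGT_sort _ |>.pairwise, fun p => by simp⟩
  have hd := desc_sort R b q
  refine h1.unique ⟨List.pairwise_cons.2 ⟨fun p hp => ((hd.2 p).1 hp).2.2, hd.1⟩, fun p => ?_⟩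
  rw [List.mem_cons, hd.2]
  constructor
  · rintro (rfl | ⟨h2, h3⟩)
    · exact ⟨hq, by omega⟩
    · exact ⟨h2, by omega⟩
  · rintro ⟨h2, h3⟩
    rcases eq_or_lt_of_le (Nat.lt_succ_iff.1 h3.2) with h4 | h4
    · exact Or.inl h4
    · exact Or.inr ⟨h2, h3.1, h4⟩

section

variable {i b : ℕ} {R : Finset ℕ} {f g : ℕ → ℕ}

theorem exists_runHead_of_critical {q : ℕ} (hF : Frame i b R) (hf : IsMatch R f)
    (hne : ∀ p ∈ R, f p ≠ i) (hc : Critical i b R f q) :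
    ∃ g, RunHead i b R f g ∧
      algorithmI i (R.filter fun p => b < p ∧ p ≤ q) (mkArcs R f) = mkArcs R g := by
  have hd := desc_sort R b q
  obtain ⟨g, k, hr, e⟩ := exists_runI hF (hc.inv hf hne) hd
  exact ⟨g, Or.inr ⟨q, _, k, hc, hd, hr⟩, by
    simp only [algorithmI, sort_filter_le hc.mem hc.lt, e]⟩

theorem exists_runTail (hF : Frame i b R) (hg : Ready i b R g) :
    ∃ a, RunTail i b R g a ∧
      algorithmII i (R.filter fun p => i < p ∧ p ≤ b) (mkArcs R g) = mkArcs R a := by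
  rcases hF.mem with rfl | hb
  · refine ⟨g, Or.inl ⟨rfl, rfl⟩, ?_⟩
    rw [Finset.filter_false_of_mem (by intro p _; omega)]
    simp [algorithmII]
  · have hib : i < b := lt_of_le_of_ne hF.le fun e => hF.not_mem (e ▸ hb)
    have hd := desc_sort R i b
    obtain ⟨h, hbo, e⟩ := exists_borrow hg hb
    have hp := hbo.props hF hg hb
    obtain ⟨a, hr, e'⟩ := exists_runII hp.rearr.isMatch (hp.rearr.ne_of_ne hg.ne) hb hp.large hd
    refine ⟨a, Or.inr ⟨hib, hb, h, _, hd, hbo, hr⟩, ?_⟩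
    simp only [algorithmII, sort_filter_le hb hib, e, e']

theorem region_mkArcs : region i (mkArcs R f) = R.filter fun p => i < p := by
  simp [region]

theorem isCriticalLarge_mkArcs {p : ℕ} (hp : p ∈ R) :
    IsCriticalLarge i (mkArcs R f) (f p, p) ↔
      f p < i ∧ i < p ∧ ∀ p' ∈ R, f p' < i → i < p' → p' ≤ p := by
  simp only [IsCriticalLarge, region_mkArcs, forall_mem_mkArcs, Finset.mem_filter]
  simp only [pair_mem_mkArcs, hp]
  constructor
  · rintro ⟨_, h1, h2, h3⟩; exact ⟨h1, h2.2, fun p' hp' h4 h5 => h3 p' hp' h4 ⟨hp', h5⟩⟩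
  · rintro ⟨h1, h2, h3⟩
    exact ⟨⟨trivial, trivial⟩, h1, ⟨trivial, h2⟩, fun p' hp' h4 h5 => h3 p' hp' h4 h5.2⟩

theorem isCriticalSmall_mkArcs {m q : ℕ} (hm : m ∈ R) (hq : q ∈ R)
    (hml : IsCriticalLarge i (mkArcs R f) (f m, m)) :
    IsCriticalSmall i (mkArcs R f) (f q, q) ↔
      i < f q ∧ (f q < m ∧ m < q) ∧ ∀ p ∈ R, i < f p → f p < m → m < p → f q ≤ f p := by
  have hml' := (isCriticalLarge_mkArcs hm).1 hml
  simp only [IsCriticalSmall, forall_mem_mkArcs, exists_mem_mkArcs, Crosses]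
  constructor
  · rintro ⟨p, hp, h1, -, h2, h3, h4⟩
    have h1' := (isCriticalLarge_mkArcs hp).1 h1
    obtain rfl : p = m := le_antisymm (hml'.2.2 p hp h1'.1 h1'.2.1)
      (h1'.2.2 m hm hml'.1 hml'.2.1)
    exact ⟨h2, h3.2, fun p' hp' h5 h6 h7 => h4 p' hp' h5 ⟨by omega, h6, h7⟩⟩
  · rintro ⟨h2, h3, h4⟩
    exact ⟨m, hm, hml, by simp [hq], h2, ⟨by omega, h3⟩,
      fun p hp h5 h6 => h4 p hp h5 h6.2.1 h6.2.2⟩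

/-- The two algorithms applied to a matching. -/
theorem exists_run (hf : IsMatch R f) (hi : i ∉ R) (hne : ∀ p ∈ R, f p ≠ i) :
    ∃ b a, Run i b R f a ∧
      region2 i (mkArcs R f) = (R.filter fun p => i < p ∧ p ≤ b) ∧
      algorithmII i (region2 i (mkArcs R f)) (algorithmI i (region1 i (mkArcs R f)) (mkArcs R f)) =
        mkArcs R a := by
  -- it suffices to identify the regions and to describe the first algorithm
  suffices H : ∃ b g, Frame i b R ∧ RunHead i b R f g ∧
      region2 i (mkArcs R f) = (R.filter fun p => i < p ∧ p ≤ b) ∧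
      algorithmI i (region1 i (mkArcs R f)) (mkArcs R f) = mkArcs R g by
    obtain ⟨b, g, hF, hh, e1, e2⟩ := H
    obtain ⟨a, ht, e3⟩ := exists_runTail hF (hh.props hF hf hne).ready
    exact ⟨b, a, ⟨hF, g, hh, ht⟩, e1, by rw [e1, e2, e3]⟩
  have hempty : ∀ {R₁ : Finset ℕ}, R₁ = ∅ → algorithmI i R₁ (mkArcs R f) = mkArcs R f := by
    rintro _ rfl; simp [algorithmI]
  by_cases hL : (R.filter fun p => i < p ∧ f p < i).Nonempty
  swap
  · have hL' : ∀ p ∈ R, i < p → i < f p := by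
      intro p hp h1
      by_contra h2
      have := hne p hp
      exact hL ⟨p, by simp [hp, h1]; omega⟩
    have hnl : ¬ ∃ p ∈ R, IsCriticalLarge i (mkArcs R f) (f p, p) := by
      rintro ⟨p, hp, h1⟩
      obtain ⟨h2, h3, -⟩ := (isCriticalLarge_mkArcs hp).1 h1
      have := hL' p hp h3
      omega
    have hns : ¬ ∃ p ∈ R, IsCriticalSmall i (mkArcs R f) (f p, p) := by
      rintro ⟨p, hp, e, he, h1, -⟩
      obtain ⟨h2, h3⟩ := mem_mkArcs.1 he
      exact hnl ⟨e.2, h2, by rwa [← h3]⟩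
    refine ⟨i, f, ⟨hi, le_rfl, Or.inl rfl⟩, Or.inl ⟨Or.inl rfl, hL', rfl⟩, ?_, hempty ?_⟩
    · simp only [region2, exists_mem_mkArcs, region_mkArcs, Finset.filter_filter]
      refine Finset.filter_congr fun p _ => ?_
      constructor
      · rintro ⟨h1, ⟨s, hs, h2, -⟩ | ⟨-, s, hs, h2, -⟩⟩
        · exact absurd ⟨s, hs, h2⟩ hns
        · exact absurd ⟨s, hs, h2⟩ hnl
      · intro h; omega
    · simp only [region1, exists_mem_mkArcs, region_mkArcs, Finset.filter_filter]
      refine Finset.filter_false_of_mem ?_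
      rintro p _ ⟨h1, s, hs, h2, -⟩
      exact hns ⟨s, hs, h2⟩
  obtain ⟨m, hmmax⟩ := Finset.exists_maximal hL
  obtain ⟨hm, him, hml⟩ : m ∈ R ∧ i < m ∧ f m < i := by simpa using hmmax.1
  have hmax : ∀ p ∈ R, f p < i → i < p → p ≤ m := fun p hp h1 h2 =>
    not_lt.1 fun h => hmmax.not_gt (by simp [hp, h1, h2]) h
  have hcl := (isCriticalLarge_mkArcs (f := f) hm).2 ⟨hml, him, hmax⟩
  have hcl_iff : ∀ p ∈ R, IsCriticalLarge i (mkArcs R f) (f p, p) ↔ p = m := by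
    intro p hp
    refine ⟨fun h => ?_, fun h => h ▸ hcl⟩
    obtain ⟨h1, h2, h3⟩ := (isCriticalLarge_mkArcs hp).1 h
    exact le_antisymm (hmax p hp h1 h2) (h3 m hm hml him)
  have hafter : ∀ p ∈ R, m < p → i < f p := by
    intro p hp h1
    by_contra h2
    have := hne p hp
    have := hmax p hp (by omega) (by omega)
    omega
  by_cases hS : (R.filter fun p => i < f p ∧ f p < m ∧ m < p).Nonempty
  swap
  · have hS' : ∀ p ∈ R, i < f p → f p < m → ¬ m < p := fun p hp h1 h2 h3 =>
      hS ⟨p, by simp [hp, h1, h2, h3]⟩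
    have hns : ¬ ∃ p ∈ R, IsCriticalSmall i (mkArcs R f) (f p, p) := by
      rintro ⟨p, hp, h1⟩
      obtain ⟨h2, h3, -⟩ := (isCriticalSmall_mkArcs hm hp hcl).1 h1
      exact hS' p hp h2 h3.1 h3.2
    -- Without a critical small arc the second region reaches up to the end of the critical large
    -- arc, so `b = m` and the first algorithm is idle.
    refine ⟨m, f, ⟨hi, him.le, Or.inr hm⟩, Or.inl ⟨Or.inr hml, ?_, rfl⟩, ?_, hempty ?_⟩
    · intro p hp h1
      have h2 := hS' p hp (hafter p hp h1)
      have h3 : f p ≠ m := fun h => hf.not_mem p hp (h ▸ hm)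
      omega
    · simp only [region2, exists_mem_mkArcs, region_mkArcs, Finset.filter_filter]
      refine Finset.filter_congr fun p _ => ?_
      constructor
      · rintro ⟨h1, ⟨s, hs, h2, -⟩ | ⟨-, s, hs, h2, h3⟩⟩
        · exact absurd ⟨s, hs, h2⟩ hns
        · rw [(hcl_iff s hs).1 h2] at h3
          exact ⟨h1, h3⟩
      · rintro ⟨h1, h2⟩
        exact ⟨h1, Or.inr ⟨hns, m, hm, hcl, h2⟩⟩
    · simp only [region1, exists_mem_mkArcs, region_mkArcs, Finset.filter_filter]
      refine Finset.filter_false_of_mem ?_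
      rintro p _ ⟨h1, s, hs, h2, -⟩
      exact hns ⟨s, hs, h2⟩
  obtain ⟨q, hqS, hqmin⟩ := Finset.exists_min_image _ f hS
  obtain ⟨hq, hiq, hqm, hmq⟩ : q ∈ R ∧ i < f q ∧ f q < m ∧ m < q := by simpa using hqS
  have hqmin' : ∀ p ∈ R, i < f p → f p < m → m < p → f q ≤ f p := fun p hp h1 h2 h3 =>
    hqmin p (by simp [hp, h1, h2, h3])
  have hcs := (isCriticalSmall_mkArcs hm hq hcl).2 ⟨hiq, ⟨hqm, hmq⟩, hqmin'⟩
  have hcs_iff : ∀ p ∈ R, IsCriticalSmall i (mkArcs R f) (f p, p) ↔ p = q := by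
    intro p hp
    refine ⟨fun h => ?_, fun h => h ▸ hcs⟩
    obtain ⟨h1, ⟨h2, h3⟩, h4⟩ := (isCriticalSmall_mkArcs hm hp hcl).1 h
    exact hf.inj hp hq (le_antisymm (h4 q hq hiq hqm hmq) (hqmin' p hp h1 h2 h3))
  -- With a critical small arc, `b` is the last right-hand endpoint between `i` and `f q`, or `i` if
  -- there is none; this makes `f q` adjoin `b`.
  obtain ⟨b, hbmem, hbmax⟩ : ∃ b ∈ insert i (R.filter fun p => i < p ∧ p < f q),
      ∀ p ∈ insert i (R.filter fun p => i < p ∧ p < f q), p ≤ b :=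
    ⟨_, Finset.max'_mem _ (Finset.insert_nonempty _ _), fun p hp => Finset.le_max' _ p hp⟩
  have hib : i ≤ b := hbmax i (by simp)
  have hbq : b < f q := by
    rcases Finset.mem_insert.1 hbmem with h | h
    · omega
    · exact ((Finset.mem_filter.1 h).2).2
  have hbR : b = i ∨ b ∈ R := by
    rcases Finset.mem_insert.1 hbmem with h | h
    · exact Or.inl h
    · exact Or.inr (Finset.mem_filter.1 h).1
  have hF : Frame i b R := ⟨hi, hib, hbR⟩
  have hle_iff : ∀ p ∈ R, i < p → (p ≤ b ↔ p < f q) := fun p hp h1 =>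
    ⟨fun h => by omega, fun h => hbmax p (by simp [hp, h1, h])⟩
  have hcrit : Critical i b R f q := by
    refine ⟨hq, by omega, ⟨hbq, fun r hr h1 => ?_⟩, fun p hp h1 => ?_, m, hm, by omega, hml,
      fun p hp h1 => ?_⟩
    · have := hle_iff r hr (by omega)
      omega
    · have h2 := hafter p hp (by omega)
      by_contra h3
      have := hqmin' p hp h2 (by omega) (by omega)
      omega
    · have h2 := hafter p hp (by omega)
      by_contra h3
      have := hqmin' p hp h2 (by omega) (by omega)
      omega
  obtain ⟨g, hh, e⟩ := exists_runHead_of_critical hF hf hne hcrit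
  refine ⟨b, g, hF, hh, ?_, ?_⟩
  · simp only [region2, exists_mem_mkArcs, region_mkArcs, Finset.filter_filter]
    refine Finset.filter_congr fun p hp => ?_
    constructor
    · rintro ⟨h1, ⟨s, hs, h2, h3⟩ | ⟨h2, -⟩⟩
      · rw [(hcs_iff s hs).1 h2] at h3
        exact ⟨h1, (hle_iff p hp h1).2 h3⟩
      · exact absurd ⟨q, hq, hcs⟩ h2
    · rintro ⟨h1, h2⟩
      exact ⟨h1, Or.inl ⟨q, hq, hcs, (hle_iff p hp h1).1 h2⟩⟩
  · rw [← e]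
    congr 1
    simp only [region1, exists_mem_mkArcs, region_mkArcs, Finset.filter_filter]
    refine Finset.filter_congr fun p hp => ?_
    constructor
    · rintro ⟨h1, s, hs, h2, h3, h4⟩
      rw [(hcs_iff s hs).1 h2] at h3 h4
      exact ⟨by omega, h4⟩
    · rintro ⟨h1, h2⟩
      have h3 := hle_iff p hp (by omega)
      have h4 : f q ≠ p := fun h => hf.not_mem q hq (h ▸ hp)
      exact ⟨by omega, q, hq, hcs, by omega, h2⟩

end

/-! ### Exposed arcs -/

/-- The left-hand endpoints of the arcs that are not nested in another arc. -/
def exposed (R : Finset ℕ) (f : ℕ → ℕ) : Finset ℕ :=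
  (R.filter fun p => ∀ p' ∈ R, f p' < f p → p' < p).image f

/-- The elements of `R` between `i` and the first element of `E` to the right of `i`. -/
def freeEnds (i : ℕ) (R E : Finset ℕ) : Finset ℕ :=
  R.filter fun r => i < r ∧ ∀ l ∈ E, i < l → r ≤ l

theorem mem_exposed {R : Finset ℕ} {f : ℕ → ℕ} {x : ℕ} :
    x ∈ exposed R f ↔ ∃ p ∈ R, (∀ p' ∈ R, f p' < f p → p' < p) ∧ f p = x := by
  simp [exposed, and_assoc]

/-- The last arc that starts to the left of `r` is exposed. -/
theorem exists_exposed_cover {R : Finset ℕ} {f : ℕ → ℕ} (hlt : ∀ p ∈ R, f p < p) {r : ℕ}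
    (hr : r ∈ R) : ∃ t ∈ R, f t < r ∧ (∀ s ∈ R, f s < r → s ≤ t) ∧
      ∀ p' ∈ R, f p' < f t → p' < t := by
  have hne : (R.filter fun s => f s < r).Nonempty := ⟨r, by simp [hr, hlt r hr]⟩
  obtain ⟨t, ht⟩ := Finset.exists_maximal hne
  obtain ⟨htR, h1⟩ : t ∈ R ∧ f t < r := by simpa using ht.1
  have hmax : ∀ s ∈ R, f s < r → s ≤ t := fun s hs h => not_lt.1 fun h' =>
    ht.not_gt (by simp [hs, h]) h'
  refine ⟨t, htR, h1, hmax, fun p' hp' h2 => ?_⟩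
  refine lt_of_le_of_ne (hmax p' hp' (by omega)) ?_
  rintro rfl
  omega

/-- The last arc ends beyond all others: it is exposed, and it hides exactly the arcs that start
after it. So only exposed left-hand endpoints below `f v` have to be controlled in the induction. -/
theorem exposed_insert {R : Finset ℕ} {f : ℕ → ℕ} {v : ℕ} (hv : ∀ p ∈ R, p < v)
    (hinj : Set.InjOn f (insert v R : Finset ℕ)) :
    exposed (insert v R) f = insert (f v) ((exposed R f).filter fun x => x < f v) := by
  ext x
  simp only [mem_exposed, Finset.mem_insert, Finset.mem_filter]
  constructor
  · rintro ⟨p, rfl | hp, h1, rfl⟩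
    · exact Or.inl rfl
    · refine Or.inr ⟨⟨p, hp, fun p' hp' => h1 p' (Or.inr hp'), rfl⟩, ?_⟩
      have h2 := hv p hp
      have h3 : f p ≠ f v := fun e => h2.ne (hinj (by simp [hp]) (by simp) e)
      by_contra h4
      have := h1 v (Or.inl rfl) (by omega)
      omega
  · rintro (rfl | ⟨⟨p, hp, h1, rfl⟩, h2⟩)
    · refine ⟨v, Or.inl rfl, ?_, rfl⟩
      rintro p' (rfl | hp') h
      · omega
      · exact hv p' hp'
    · refine ⟨p, Or.inr hp, ?_, rfl⟩
      rintro p' (rfl | hp') h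
      · omega
      · exact h1 p' hp' h

theorem Rearr.symm {i : ℕ} {R : Finset ℕ} {f g : ℕ → ℕ} (hf : IsMatch R f)
    (h : Rearr i R f g) : Rearr i R g f where
  isMatch := hf
  image_eq := h.image_eq.symm
  order p hp p' hp' q hq q' hq' e e' h1 h2 hlt := by
    rcases lt_trichotomy q q' with h3 | rfl | h3
    · exact h3
    · have := h.isMatch.inj hp hp' (e.trans e'.symm); omega
    · have := h.order q' hq' q hq p' hp' p hp e'.symm e.symm (by omega) (by omega) h3
      omega

/-- Only arcs starting even further to the left can contain an arc starting before `i`, and the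
order of the ends of such arcs is preserved. -/
theorem Rearr.mem_exposed_of_lt {i : ℕ} {R : Finset ℕ} {f g : ℕ → ℕ} (h : Rearr i R f g)
    {x : ℕ} (hx : x < i) (hxe : x ∈ exposed R f) : x ∈ exposed R g := by
  obtain ⟨p, hp, h1, rfl⟩ := mem_exposed.1 hxe
  obtain ⟨q, hq, e⟩ := h.exists_right hp
  refine mem_exposed.2 ⟨q, hq, fun q' hq' h2 => ?_, e⟩
  obtain ⟨p', hp', e'⟩ := h.exists_left hq'
  exact h.order p' hp' p hp q' hq' q hq e' e.symm (by omega) hx (h1 p' hp' (by omega))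

theorem Rearr.exposed_filter {i : ℕ} {R : Finset ℕ} {f g : ℕ → ℕ} (hf : IsMatch R f)
    (h : Rearr i R f g) :
    (exposed R g).filter (fun x => x < i) = (exposed R f).filter fun x => x < i := by
  ext x
  simp only [Finset.mem_filter]
  exact ⟨fun ⟨h1, h2⟩ => ⟨(h.symm hf).mem_exposed_of_lt h2 h1, h2⟩,
    fun ⟨h1, h2⟩ => ⟨h.mem_exposed_of_lt h2 h1, h2⟩⟩

/-- The second region in terms of exposed arcs. -/
theorem Run.freeEnds_eq {i b : ℕ} {R : Finset ℕ} {f a : ℕ → ℕ} (hf : IsMatch R f)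
    (hr : Run i b R f a) :
    (R.filter fun p => i < p ∧ p ≤ b) = freeEnds i R (exposed R f) := by
  obtain ⟨hF, g, hh, -⟩ := hr
  have hib := hF.le
  refine Finset.filter_congr fun p hp => and_congr_right fun hip => ?_
  constructor
  · intro hpb l hl hil
    obtain ⟨s, hs, h1, rfl⟩ := mem_exposed.1 hl
    by_contra h2
    -- An exposed arc starting after `i` must end after the critical large arc, and all arcs ending
    -- there start after `b`.
    rcases hh with ⟨h3, h4, -⟩ | ⟨q, l, k, hc, -, -⟩
    · rcases h3 with h3 | h3
      · omega
      · have hb : b ∈ R := by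
          rcases hF.mem with h | h
          · omega
          · exact h
        have := h4 s hs (h1 b hb (by omega))
        omega
    · obtain ⟨m, hm, h3, h4, h5⟩ := hc.large
      have := h5 s hs (h1 m hm (by omega))
      omega
  · intro h
    by_contra hpb
    obtain ⟨t, ht, h1, h2, h3⟩ := exists_exposed_cover hf.lt hp
    have h4 := h2 p hp (hf.lt p hp)
    have h5 := h (f t) (mem_exposed.2 ⟨t, ht, h3, rfl⟩)
    -- The farthest arc over `p` is exposed. If `p` is beyond `b`, then this arc starts between `b`
    -- and `p`, so `p` is not free.
    suffices b < f t by omega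
    rcases hh with ⟨h6, h7, -⟩ | ⟨q, l, k, hc, -, -⟩
    · exact h7 t ht (by omega)
    · have h8 : f q < p := lt_of_le_of_ne (hc.adj.2 p hp (by omega))
        fun e => hf.not_mem q hc.mem (e ▸ hp)
      rcases eq_or_lt_of_le (h2 q hc.mem h8) with rfl | h9
      · exact hc.adj.1
      · exact hc.after t ht h9

/-! ### The p-major index -/

/-- The number of adjacent pairs in a list along which `f` increases. -/
def asc (f : ℕ → ℕ) : List ℕ → ℕ
  | a :: b :: l => (if f a < f b then 1 else 0) + asc f (b :: l)
  | _ => 0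

/-- The right-hand endpoints of the arcs over `r`, in increasing order. -/
def arcsOver (R : Finset ℕ) (f : ℕ → ℕ) (r : ℕ) : List ℕ :=
  (R.filter fun s => f s < r ∧ r ≤ s).sort (· ≤ ·)

/-- The p-major index of `mkArcs R f`. -/
def majNum (R : Finset ℕ) (f : ℕ → ℕ) : ℕ := ∑ r ∈ R, asc f (arcsOver R f r)

theorem asc_append_pair (f : ℕ → ℕ) (l : List ℕ) (t v : ℕ) :
    asc f (l ++ [t] ++ [v]) = asc f (l ++ [t]) + if f t < f v then 1 else 0 := by
  induction l with
  | nil => simp [asc]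
  | cons a l ih =>
    cases l with
    | nil => simp [asc]
    | cons b l =>
      simp only [List.cons_append, asc] at ih ⊢
      omega

theorem mem_arcsOver {R : Finset ℕ} {f : ℕ → ℕ} {r s : ℕ} :
    s ∈ arcsOver R f r ↔ s ∈ R ∧ f s < r ∧ r ≤ s := by
  simp [arcsOver]

theorem arcsOver_pairwise (R : Finset ℕ) (f : ℕ → ℕ) (r : ℕ) : (arcsOver R f r).Pairwise (· < ·) :=
  (Finset.sortedLT_sort _).pairwise

theorem eq_arcsOver {R : Finset ℕ} {f : ℕ → ℕ} {r : ℕ} {l : List ℕ} (h : l.Pairwise (· < ·))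
    (hl : ∀ s, s ∈ l ↔ s ∈ R ∧ f s < r ∧ r ≤ s) : l = arcsOver R f r := by
  have hn : l.Nodup := h.imp (fun h => ne_of_lt h)
  have hn' : (arcsOver R f r).Nodup := (arcsOver_pairwise R f r).imp (fun h => ne_of_lt h)
  have hp : l.Perm (arcsOver R f r) := (List.perm_ext_iff_of_nodup hn hn').2 fun s => by
    rw [hl, mem_arcsOver]
  exact hp.eq_of_pairwise (fun a b _ _ h1 h2 => by omega) h (arcsOver_pairwise R f r)

/-- The new arc has the largest right-hand endpoint, so it becomes the last letter of each word with
`r > f v` and leaves the other words of `R` unchanged. The word at `v` has one letter only. -/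
theorem majNum_insert {R : Finset ℕ} {f : ℕ → ℕ} {v : ℕ} (hv : ∀ p ∈ R, p < v)
    (hinj : Set.InjOn f (insert v R : Finset ℕ)) (hlt : ∀ p ∈ insert v R, f p < p) :
    majNum (insert v R) f = majNum R f + (freeEnds (f v) R (exposed R f)).card := by
  have hvR : v ∉ R := fun h => lt_irrefl _ (hv v h)
  have hlt' : ∀ p ∈ R, f p < p := fun p hp => hlt p (by simp [hp])
  rw [majNum, Finset.sum_insert hvR, majNum, freeEnds, Finset.card_filter, ← Finset.sum_add_distrib]
  have h0 : arcsOver (insert v R) f v = [v] := by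
    refine (eq_arcsOver (by simp) fun s => ?_).symm
    simp only [List.mem_singleton, Finset.mem_insert]
    constructor
    · rintro rfl; exact ⟨Or.inl rfl, hlt s (by simp), le_rfl⟩
    · rintro ⟨h1 | h1, h2, h3⟩
      · exact h1
      · have := hv s h1; omega
  have h1 : asc f [v] = 0 := rfl
  rw [h0, h1, zero_add]
  refine Finset.sum_congr rfl fun r hr => ?_
  have hrv := hv r hr
  by_cases hi : f v < r
  · have e1 : arcsOver (insert v R) f r = arcsOver R f r ++ [v] := by
      refine (eq_arcsOver ?_ fun s => ?_).symm
      · rw [List.pairwise_append]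
        refine ⟨arcsOver_pairwise R f r, by simp, fun s hs s' hs' => ?_⟩
        rw [List.mem_singleton] at hs'
        exact hs' ▸ hv s (mem_arcsOver.1 hs).1
      · rw [List.mem_append, mem_arcsOver, List.mem_singleton, Finset.mem_insert]
        constructor
        · rintro (h | rfl)
          · exact ⟨Or.inr h.1, h.2⟩
          · exact ⟨Or.inl rfl, hi, hrv.le⟩
        · rintro ⟨h | h, h'⟩
          · exact Or.inr h
          · exact Or.inl ⟨h, h'⟩
    rcases List.eq_nil_or_concat (arcsOver R f r) with h | ⟨l, t, h⟩
    · have : r ∈ arcsOver R f r := mem_arcsOver.2 ⟨hr, hlt' r hr, le_rfl⟩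
      simp [h] at this
    · rw [List.concat_eq_append] at h
      have htm : t ∈ arcsOver R f r := by simp [h]
      obtain ⟨ht, htr, hrt⟩ := mem_arcsOver.1 htm
      have hmax : ∀ s ∈ R, f s < r → s ≤ t := by
        intro s hs h2
        by_contra h3
        have h4 : s ∈ arcsOver R f r := mem_arcsOver.2 ⟨hs, h2, by omega⟩
        have h5 := arcsOver_pairwise R f r
        rw [h, List.pairwise_append] at h5
        rw [h, List.mem_append, List.mem_singleton] at h4
        rcases h4 with h4 | h4
        · have := h5.2.2 s h4 t (by simp); omega
        · omega
      rw [e1, h, asc_append_pair]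
      congr 1
      -- The previous last letter `t` is exposed, and `f t` is the largest exposed left-hand
      -- endpoint below `r`; hence `f t < f v` means that none lies between `f v` and `r`.
      refine if_congr ⟨fun h2 => ⟨hi, fun x hx hvx => ?_⟩, fun h2 => ?_⟩ rfl rfl
      · obtain ⟨s, hs, h3, rfl⟩ := mem_exposed.1 hx
        by_contra h4
        have h5 := hmax s hs (by omega)
        have h6 := h3 t ht (by omega)
        omega
      · have h3 : f t ≠ f v := fun e => (hv t ht).ne (hinj (by simp [ht]) (by simp) e)
        by_contra h4
        have h5 := h2.2 (f t) (mem_exposed.2 ⟨t, ht, fun p' hp' h6 => ?_, rfl⟩) (by omega)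
        · omega
        · refine lt_of_le_of_ne (hmax p' hp' (by omega)) ?_
          rintro rfl; omega
  · have e1 : arcsOver (insert v R) f r = arcsOver R f r := by
      refine eq_arcsOver (arcsOver_pairwise _ _ _) fun s => ?_
      rw [mem_arcsOver, Finset.mem_insert]
      constructor
      · rintro ⟨rfl | h, h'⟩
        · omega
        · exact ⟨h, h'⟩
      · rintro ⟨h, h'⟩; exact ⟨Or.inr h, h'⟩
    rw [e1, if_neg (by tauto), add_zero]

/-! ### Labels, and the words `σ` as lists of covering arcs. -/

theorem label_mkArcs {R : Finset ℕ} {f : ℕ → ℕ} (e : ℕ × ℕ) :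
    label (mkArcs R f) e = (R.filter fun p => e.1 ≤ f p).card := by
  rw [label, mkArcs, Finset.filter_image, Finset.card_image_of_injective]
  intro a b h
  exact congrArg Prod.snd h

/-- Labels reverse the order of left-hand endpoints, so descents of labels are ascents of left-hand
endpoints. -/
theorem label_lt_iff {R : Finset ℕ} {f : ℕ → ℕ} {s t : ℕ} (hs : s ∈ R) (ht : t ∈ R) :
    label (mkArcs R f) (f t, t) < label (mkArcs R f) (f s, s) ↔ f s < f t := by
  have key : ∀ {s t : ℕ}, s ∈ R → f s < f t →
      label (mkArcs R f) (f t, t) < label (mkArcs R f) (f s, s) := by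
    intro s t hs h
    rw [label_mkArcs, label_mkArcs]
    refine Finset.card_lt_card ⟨fun p hp => ?_, fun h' => ?_⟩
    · simp only [Finset.mem_filter] at hp ⊢
      exact ⟨hp.1, by omega⟩
    · have := h' (show s ∈ _ by simp [hs])
      simp only [Finset.mem_filter] at this
      omega
  refine ⟨fun h => ?_, key hs⟩
  rcases lt_trichotomy (f s) (f t) with h' | h' | h'
  · exact h'
  · rw [label_mkArcs, label_mkArcs] at h
    simp [h'] at h
  · have := key ht h'
    omega

theorem des_map_labelAt {R : Finset ℕ} {f : ℕ → ℕ} {l : List ℕ} (hl : ∀ s ∈ l, s ∈ R) :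
    des (l.map (labelAt (mkArcs R f))) = asc f l := by
  induction l with
  | nil => rfl
  | cons a l ih =>
    cases l with
    | nil => rfl
    | cons b l =>
      have ha := hl a (by simp)
      have hb := hl b (by simp)
      have := ih fun s hs => hl s (by simp [hs])
      simp only [List.map_cons, des, asc] at this ⊢
      rw [this]
      congr 1
      refine if_congr ?_ rfl rfl
      rw [labelAt, labelAt, leftOf_mkArcs ha, leftOf_mkArcs hb]
      exact label_lt_iff ha hb

/-- Passing to the next endpoint `x` deletes exactly the arcs over `r` that start at or after `x`;
those left end after `x`, so writing `x` in front keeps the ends increasing. -/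
theorem sigmaFrom_mkArcs {R : Finset ℕ} {f : ℕ → ℕ} (hlt : ∀ p ∈ R, f p < p) {r : ℕ}
    {l : List ℕ} (hd : Desc R 0 r l) :
    sigmaFrom (mkArcs R f) r ((arcsOver R f r).map (labelAt (mkArcs R f))) l =
      l.map fun r' => (arcsOver R f r').map (labelAt (mkArcs R f)) := by
  induction l generalizing r with
  | nil => rfl
  | cons x l ih =>
    obtain ⟨h1, h2, h3, h4, h5⟩ := hd.of_cons
    have e : labelAt (mkArcs R f) x :: (((arcsOver R f r).map (labelAt (mkArcs R f))).filter fun a =>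
        ¬ ∃ e ∈ mkArcs R f, label (mkArcs R f) e = a ∧ x ≤ e.1 ∧ e.1 < r) =
        (arcsOver R f x).map (labelAt (mkArcs R f)) := by
      have e1 : arcsOver R f x = x :: (arcsOver R f r).filter fun s => f s < x := by
        refine (eq_arcsOver ?_ fun s => ?_).symm
        · refine List.pairwise_cons.2 ⟨fun s hs => ?_, (arcsOver_pairwise R f r).filter _⟩
          have := mem_arcsOver.1 (List.mem_filter.1 hs).1
          omega
        · rw [List.mem_cons, List.mem_filter, mem_arcsOver, decide_eq_true_eq]
          constructor
          · rintro (rfl | ⟨⟨h6, h7, h8⟩, h9⟩)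
            · exact ⟨h1, hlt s h1, le_rfl⟩
            · exact ⟨h6, h9, by omega⟩
          · rintro ⟨h6, h7, h8⟩
            rcases eq_or_lt_of_le h8 with h9 | h9
            · exact Or.inl h9.symm
            · have := h4 s h6 h9
              exact Or.inr ⟨⟨h6, by omega, this⟩, h7⟩
      rw [e1, List.map_cons, List.filter_map]
      congr 2
      refine List.filter_congr fun s hs => ?_
      obtain ⟨h6, h7, h8⟩ := mem_arcsOver.1 hs
      simp only [Function.comp, exists_mem_mkArcs, decide_eq_decide]
      constructor
      · intro h
        by_contra h9
        exact h ⟨s, h6, by rw [labelAt, leftOf_mkArcs h6], by omega, h7⟩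
      · rintro h9 ⟨t, ht, h10, h11, h12⟩
        rw [labelAt, leftOf_mkArcs h6] at h10
        have h13 := label_lt_iff (f := f) ht h6
        have h14 := label_lt_iff (f := f) h6 ht
        omega
    simp only [sigmaFrom, List.map_cons]
    rw [e, ih h5]

theorem arcPmaj_mkArcs {R : Finset ℕ} {f : ℕ → ℕ} (hlt : ∀ p ∈ R, f p < p) :
    arcPmaj (mkArcs R f) = majNum R f := by
  have hs : sigmas (mkArcs R f) =
      (R.sort (· ≥ ·)).map fun r => (arcsOver R f r).map (labelAt (mkArcs R f)) := by
    rw [sigmas, rightEnds_mkArcs]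
    have hmem : ∀ p, p ∈ R.sort (· ≥ ·) ↔ p ∈ R := fun p => by simp
    have hpw : (R.sort (· ≥ ·)).Pairwise (· > ·) := (Finset.sortedGT_sort _).pairwise
    generalize R.sort (· ≥ ·) = l at hmem hpw
    cases l with
    | nil => rfl
    | cons r l =>
      -- The bounds `0` and `r + 1` exclude nothing: right-hand endpoints are positive because `f p
      -- < p`, and `r` is the largest one.
      have hd : Desc R 0 (r + 1) (r :: l) := by
        refine ⟨hpw, fun p => ⟨fun hp => ?_, fun hp => (hmem p).2 hp.1⟩⟩
        have hpR := (hmem p).1 hp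
        have := hlt p hpR
        refine ⟨hpR, by omega, ?_⟩
        rcases List.mem_cons.1 hp with rfl | h
        · omega
        · have := (List.pairwise_cons.1 hpw).1 p h; omega
      obtain ⟨h1, h2, h3, h4, h5⟩ := hd.of_cons
      have e : arcsOver R f r = [r] := by
        refine (eq_arcsOver (by simp) fun s => ?_).symm
        rw [List.mem_singleton]
        constructor
        · rintro rfl; exact ⟨h1, hlt s h1, le_rfl⟩
        · rintro ⟨h6, h7, h8⟩
          rcases List.mem_cons.1 ((hmem s).2 h6) with h | h
          · exact h
          · have := (List.pairwise_cons.1 hpw).1 s h; omega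
      have := sigmaFrom_mkArcs hlt h5
      rw [e] at this
      simp only [List.map_cons, List.map_nil] at this ⊢
      rw [this, e]
      rfl
  rw [arcPmaj, hs, List.map_map, majNum, ← Finset.sort_toFinset R (· ≥ ·),
    List.sum_toFinset _ (Finset.sort_nodup _ _), Finset.sort_toFinset]
  congr 1
  refine List.map_congr_left fun r _ => ?_
  exact des_map_labelAt fun s hs => (mem_arcsOver.1 hs).1

/-! ### The map `phi` -/

theorem phi_mkArcs_insert {R : Finset ℕ} {f : ℕ → ℕ} {v : ℕ} (hv : ∀ p ∈ R, p < v) :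
    phi (mkArcs (insert v R) f) = insert (f v, v) (algorithmII (f v)
      (region2 (f v) (phi (mkArcs R f)))
        (algorithmI (f v) (region1 (f v) (phi (mkArcs R f))) (phi (mkArcs R f)))) := by
  have hvR : v ∉ R := fun h => lt_irrefl _ (hv v h)
  have hne : (rightEnds (mkArcs (insert v R) f)).Nonempty := by simp
  have hmax : (rightEnds (mkArcs (insert v R) f)).max' hne = v := by
    refine le_antisymm (Finset.max'_le _ _ _ fun p hp => ?_) (Finset.le_max' _ _ (by simp))
    rw [rightEnds_mkArcs, Finset.mem_insert] at hp
    rcases hp with rfl | hp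
    · exact le_rfl
    · exact (hv p hp).le
  rw [phi, dif_pos hne]
  simp only [hmax]
  rw [leftOf_mkArcs (by simp), filter_mkArcs_ne, Finset.erase_insert hvR]

/-- An arc starting before `i` either ends after `i` or is one of the arcs ending at or before `i`.
So the number of large arcs depends on the two endpoint sets only. -/
theorem card_large_after {i : ℕ} {R : Finset ℕ} {f : ℕ → ℕ} (hf : IsMatch R f) :
    (R.filter fun p => i < p ∧ f p < i).card + (R.filter fun p => p ≤ i).card =
      ((R.image f).filter fun x => x < i).card := by
  rw [Finset.filter_image, Finset.card_image_of_injOn (hf.inj.mono fun p hp => (Finset.mem_filter.1 hp).1),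
    ← Finset.card_union_of_disjoint]
  · congr 1
    ext p
    simp only [Finset.mem_union, Finset.mem_filter]
    constructor
    · rintro (h | h)
      · exact ⟨h.1, h.2.2⟩
      · exact ⟨h.1, (hf.lt p h.1).trans_le h.2⟩
    · rintro ⟨h1, h2⟩
      rcases le_or_gt p i with h3 | h3 <;> tauto
  · rw [Finset.disjoint_filter]
    intro p _ h1 h2
    omega

theorem crossNum_insert_last {R : Finset ℕ} {f : ℕ → ℕ} {v : ℕ} (hv : ∀ p ∈ R, p < v) :
    crossNum (insert v R) f = crossNum R f + (R.filter fun p => f v < p ∧ f p < f v).card := by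
  have hvR : v ∉ R := fun h => lt_irrefl _ (hv v h)
  rw [crossNum, Finset.sum_insert hvR, Finset.sum_insert hvR, Finset.card_filter]
  have h1 : ∑ q ∈ R, crossInd f v q = 0 := Finset.sum_eq_zero fun q hq => by
    have := hv q hq
    rw [crossInd, if_neg (by omega)]
  have h2 : crossInd f v v = 0 := by simp [crossInd]
  rw [h1, h2, zero_add, zero_add, crossNum, ← Finset.sum_add_distrib]
  refine Finset.sum_congr rfl fun p hp => ?_
  rw [Finset.sum_insert hvR, add_comm]
  congr 1
  have := hv p hp
  exact if_congr (by constructor <;> intro h <;> omega) rfl rfl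

/-- The properties of the image `mkArcs R g` of `mkArcs R f` under `phi`. -/
structure PhiProps (R : Finset ℕ) (f g : ℕ → ℕ) : Prop where
  eq : phi (mkArcs R f) = mkArcs R g
  isMatch : IsMatch R g
  image_eq : R.image g = R.image f
  exposed_eq : exposed R g = exposed R f
  cross : crossNum R g = majNum R f

theorem IsMatch.of_insert {R : Finset ℕ} {f : ℕ → ℕ} {v : ℕ} (hf : IsMatch (insert v R) f) :
    IsMatch R f where
  inj := hf.inj.mono (by simp)
  lt p hp := hf.lt p (by simp [hp])
  not_mem p hp h := hf.not_mem p (by simp [hp]) (by simp [h])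

theorem exists_run_phi {R : Finset ℕ} {f g : ℕ → ℕ} {v : ℕ} (hv : ∀ p ∈ R, p < v)
    (hf : IsMatch (insert v R) f) (hg : PhiProps R f g) :
    (∀ p ∈ R, g p ≠ f v) ∧ ∃ b a, Run (f v) b R g a ∧
      phi (mkArcs (insert v R) f) = mkArcs (insert v R) (Function.update a v (f v)) := by
  have hvR : v ∉ R := fun h => lt_irrefl _ (hv v h)
  have hi : f v ∉ R := fun h => hf.not_mem v (by simp) (by simp [h])
  have hne : ∀ p ∈ R, g p ≠ f v := by
    intro p hp e
    have : g p ∈ R.image f := hg.image_eq ▸ Finset.mem_image_of_mem g hp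
    obtain ⟨q, hq, e'⟩ := Finset.mem_image.1 this
    have := hf.inj (by simp [hq]) (by simp) (e'.trans e)
    exact hvR (this ▸ hq)
  obtain ⟨b, a, hr, -, e⟩ := exists_run hg.isMatch hi hne
  refine ⟨hne, b, a, hr, ?_⟩
  rw [phi_mkArcs_insert hv, hg.eq, e]
  have h1 := insert_mkArcs (R := insert v R) (f := Function.update a v (f v))
    (Finset.mem_insert_self v R)
  rw [Function.update_self, Finset.erase_insert hvR] at h1
  rw [← h1]
  congr 1
  exact mkArcs_congr fun p hp => by
    rw [Function.update_of_ne]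
    rintro rfl; exact hvR hp

/-- Equality of exposed sets is carried through the induction because the p-major index grows
according to the original matching, while the second region is that of its image. -/
theorem exists_phiProps {R : Finset ℕ} {f : ℕ → ℕ} (hf : IsMatch R f) : ∃ g, PhiProps R f g := by
  induction R using Finset.induction_on_max with
  | empty =>
    refine ⟨f, ?_, hf, rfl, rfl, by simp [crossNum, majNum]⟩
    rw [phi, dif_neg (by simp)]
    simp [mkArcs]
  | insert v R hv ih =>
    have hvR : v ∉ R := fun h => lt_irrefl _ (hv v h)
    obtain ⟨g, hg⟩ := ih hf.of_insert
    obtain ⟨hne, b, a, hr, e⟩ := exists_run_phi hv hf hg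
    have hre := hr.rearr hg.isMatch hne
    have hup : Set.EqOn (Function.update a v (f v)) a R := fun p hp => by
      rw [Function.update_of_ne]
      rintro rfl; exact hvR hp
    have hupv : Function.update a v (f v) v = f v := Function.update_self ..
    have hane := hre.ne_of_ne hne
    have himg : R.image (Function.update a v (f v)) = R.image f := by
      rw [Finset.image_congr hup, hre.image_eq, hg.image_eq]
    have hinj : Set.InjOn (Function.update a v (f v)) (insert v R : Finset ℕ) := by
      intro p hp q hq h
      rw [Finset.mem_coe, Finset.mem_insert] at hp hq
      rcases hp with rfl | hp <;> rcases hq with rfl | hq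
      · rfl
      · rw [hupv, hup hq] at h
        exact absurd h.symm (hane q hq)
      · rw [hupv, hup hp] at h
        exact absurd h (hane p hp)
      · rw [hup hp, hup hq] at h
        exact hre.isMatch.inj hp hq h
    have himg' : (insert v R).image (Function.update a v (f v)) = (insert v R).image f := by
      rw [Finset.image_insert, Finset.image_insert, himg, hupv]
    refine ⟨_, e, ⟨hinj, ?_, ?_⟩, himg', ?_, ?_⟩
    · intro p hp
      rcases Finset.mem_insert.1 hp with rfl | hp'
      · rw [hupv]; exact hf.lt p hp
      · rw [hup hp']; exact hre.isMatch.lt p hp'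
    · intro p hp
      have : Function.update a v (f v) p ∈ (insert v R).image f :=
        himg' ▸ Finset.mem_image_of_mem _ hp
      obtain ⟨q, hq, e'⟩ := Finset.mem_image.1 this
      rw [← e']
      exact hf.not_mem q hq
    · rw [exposed_insert hv hinj, exposed_insert hv hf.inj, hupv, ← hg.exposed_eq,
        ← hre.exposed_filter hg.isMatch]
      congr 2
      ext x
      simp only [mem_exposed]
      refine exists_congr fun p => and_congr_right fun hp => ?_
      rw [hup hp]
      refine and_congr_left fun _ => forall_congr' fun p' => forall_congr' fun hp' => ?_
      rw [hup hp']
    -- The new arc crosses the large arcs of `a`, which are as many as those of `g` by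
    -- `card_large_after`. With `Run.crossNum_add` the gain is the size of the second region, which
    -- is also the gain of `majNum`.
    · rw [crossNum_insert_last hv, crossNum_congr hup, hupv, majNum_insert hv hf.inj hf.lt,
        ← hg.cross, ← hg.exposed_eq, ← hr.freeEnds_eq hg.isMatch]
      have h1 := hr.crossNum_add hg.isMatch hne
      have h2 := card_large_after (i := f v) hg.isMatch
      have h3 := card_large_after (i := f v) hre.isMatch
      rw [hre.image_eq] at h3
      have h4 : (R.filter fun p => f v < p ∧ Function.update a v (f v) p < f v) =
          R.filter fun p => f v < p ∧ a p < f v :=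
        Finset.filter_congr fun p hp => by rw [hup hp]
      rw [h4]
      omega

/-- The last arc is kept by the map, so `i` is known when the run is undone; then the induction
hypothesis applies to the rest. -/
theorem phi_injective {R : Finset ℕ} {f f' : ℕ → ℕ} (hf : IsMatch R f) (hf' : IsMatch R f')
    (h : phi (mkArcs R f) = phi (mkArcs R f')) : Set.EqOn f f' R := by
  induction R using Finset.induction_on_max with
  | empty => simp
  | insert v R hv ih =>
    have hvR : v ∉ R := fun h => lt_irrefl _ (hv v h)
    obtain ⟨g, hg⟩ := exists_phiProps hf.of_insert
    obtain ⟨g', hg'⟩ := exists_phiProps hf'.of_insert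
    obtain ⟨hne, b, a, hr, e⟩ := exists_run_phi hv hf hg
    obtain ⟨hne', b', a', hr', e'⟩ := exists_run_phi hv hf' hg'
    rw [e, e', mkArcs_inj] at h
    have hfv : f v = f' v := by simpa using h (Finset.mem_insert_self v R)
    have ha : Set.EqOn a a' R := fun p hp => by
      have hpv : p ≠ v := by rintro rfl; exact hvR hp
      simpa [Function.update_of_ne hpv] using h (Finset.mem_insert_of_mem hp)
    rw [← hfv] at hr' hne'
    have h1 := ih hf.of_insert hf'.of_insert (by
      rw [hg.eq, hg'.eq]
      exact mkArcs_congr (hr.injective hg.isMatch hne hg'.isMatch hne' hr' ha))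
    intro p hp
    rcases Finset.mem_insert.1 hp with rfl | hp
    · exact hfv
    · exact h1 hp

/-! ### Splitting the vertices -/

/-- The function describing the split arc set. -/
def splitFun (f : ℕ → ℕ) (p : ℕ) : ℕ := 2 * f (p / 2) + 1

/-- The even copies of the elements of `R`. -/
def double (R : Finset ℕ) : Finset ℕ := R.image fun y => 2 * y

theorem splitFun_two_mul (f : ℕ → ℕ) (y : ℕ) : splitFun f (2 * y) = 2 * f y + 1 := by
  simp [splitFun]

theorem mem_double {R : Finset ℕ} {p : ℕ} : p ∈ double R ↔ ∃ y ∈ R, 2 * y = p := by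
  simp [double]

theorem two_mul_mem_double {R : Finset ℕ} {y : ℕ} : 2 * y ∈ double R ↔ y ∈ R := by
  simp [double]

theorem forall_mem_double {R : Finset ℕ} {Q : ℕ → Prop} :
    (∀ p ∈ double R, Q p) ↔ ∀ y ∈ R, Q (2 * y) := by
  simp [double]

theorem splitArcs_mkArcs (R : Finset ℕ) (f : ℕ → ℕ) :
    splitArcs (mkArcs R f) = mkArcs (double R) (splitFun f) := by
  simp only [splitArcs, mkArcs, double, Finset.image_image]
  exact Finset.image_congr fun y _ => by simp [splitFun_two_mul]

theorem mergeArcs_mkArcs {R : Finset ℕ} {g h : ℕ → ℕ} (hg : ∀ y ∈ R, g (2 * y) = 2 * h y + 1) :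
    mergeArcs (mkArcs (double R) g) = mkArcs R h := by
  simp only [mergeArcs, mkArcs, double, Finset.image_image]
  refine Finset.image_congr fun y hy => ?_
  simp only [Function.comp, hg y hy, Prod.mk.injEq]
  omega

theorem isMatch_splitFun {R : Finset ℕ} {f : ℕ → ℕ} (hinj : Set.InjOn f R)
    (hlt : ∀ p ∈ R, f p < p) : IsMatch (double R) (splitFun f) where
  inj p hp q hq h := by
    obtain ⟨y, hy, rfl⟩ := mem_double.1 hp
    obtain ⟨z, hz, rfl⟩ := mem_double.1 hq
    rw [splitFun_two_mul, splitFun_two_mul] at h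
    rw [hinj hy hz (by omega)]
  lt := forall_mem_double.2 fun y hy => by
    have := hlt y hy
    rw [splitFun_two_mul]; omega
  not_mem := forall_mem_double.2 fun y _ h => by
    obtain ⟨z, _, hz⟩ := mem_double.1 h
    rw [splitFun_two_mul] at hz; omega

theorem crossNum_double {R : Finset ℕ} {g h : ℕ → ℕ} (hg : ∀ y ∈ R, g (2 * y) = 2 * h y + 1) :
    crossNum (double R) g = crossNum R h := by
  have hinj : Set.InjOn (fun y => 2 * y) (R : Set ℕ) := fun a _ b _ h => by
    simp only at h; omega
  rw [crossNum, double, Finset.sum_image hinj, crossNum]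
  refine Finset.sum_congr rfl fun p hp => ?_
  rw [Finset.sum_image hinj]
  refine Finset.sum_congr rfl fun q hq => ?_
  simp only [crossInd, hg p hp, hg q hq]
  exact if_congr (by omega) rfl rfl

theorem mem_exposed_double {R : Finset ℕ} {f : ℕ → ℕ} {x : ℕ} :
    x ∈ exposed (double R) (splitFun f) ↔ ∃ l ∈ exposed R f, 2 * l + 1 = x := by
  simp only [mem_exposed, forall_mem_double, splitFun_two_mul]
  constructor
  · rintro ⟨p, hp, h1, h2⟩
    obtain ⟨y, hy, rfl⟩ := mem_double.1 hp
    rw [splitFun_two_mul] at h1 h2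
    exact ⟨f y, ⟨y, hy, fun z hz h => by have := h1 z hz (by omega); omega, rfl⟩, h2⟩
  · rintro ⟨l, ⟨y, hy, h1, rfl⟩, h2⟩
    refine ⟨2 * y, two_mul_mem_double.2 hy, fun z hz h => ?_, by rwa [splitFun_two_mul]⟩
    rw [splitFun_two_mul] at h
    have := h1 z hz (by omega)
    omega

theorem card_freeEnds_double (R : Finset ℕ) (f : ℕ → ℕ) (i : ℕ) :
    (freeEnds (2 * i + 1) (double R) (exposed (double R) (splitFun f))).card =
      (freeEnds i R (exposed R f)).card := by
  have hinj : Function.Injective fun y : ℕ => 2 * y := fun a b h => by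
    simp only at h; omega
  rw [← Finset.card_image_of_injective (freeEnds i R (exposed R f)) hinj]
  congr 1
  ext p
  simp only [freeEnds, Finset.mem_filter, Finset.mem_image, mem_double]
  constructor
  · rintro ⟨⟨y, hy, rfl⟩, h1, h2⟩
    refine ⟨y, ⟨hy, by omega, fun l hl h3 => ?_⟩, rfl⟩
    have := h2 (2 * l + 1) (mem_exposed_double.2 ⟨l, hl, rfl⟩) (by omega)
    omega
  · rintro ⟨y, ⟨hy, h1, h2⟩, rfl⟩
    refine ⟨⟨y, hy, rfl⟩, by omega, fun l hl h3 => ?_⟩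
    obtain ⟨l, hl', rfl⟩ := mem_exposed_double.1 hl
    have := h2 l hl' (by omega)
    omega

/-- Comparing the increments of `majNum_insert` avoids comparing words. At a common vertex the
right-hand copy precedes the left-hand copy, in accordance with the weak inequality in `freeEnds`.
-/
theorem majNum_double {R : Finset ℕ} {f : ℕ → ℕ} (hinj : Set.InjOn f R)
    (hlt : ∀ p ∈ R, f p < p) : majNum (double R) (splitFun f) = majNum R f := by
  induction R using Finset.induction_on_max with
  | empty => simp [majNum, double]
  | insert v R hv ih =>
    have hm := isMatch_splitFun hinj hlt
    have e : double (insert v R) = insert (2 * v) (double R) := Finset.image_insert _ _ _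
    rw [e] at hm ⊢
    rw [majNum_insert hv hinj hlt, majNum_insert _ hm.inj hm.lt, splitFun_two_mul,
      card_freeEnds_double, ih (hinj.mono (by simp)) fun p hp => hlt p (by simp [hp])]
    exact forall_mem_double.2 fun y hy => by have := hv y hy; omega

/-- The map `phi` on arc sets in which a vertex may be a left-hand and a right-hand endpoint. -/
theorem exists_mergeArcs_phi {R : Finset ℕ} {f : ℕ → ℕ} (hinj : Set.InjOn f R)
    (hlt : ∀ p ∈ R, f p < p) :
    ∃ h, phi (splitArcs (mkArcs R f)) = mkArcs (double R) (splitFun h) ∧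
      mergeArcs (phi (splitArcs (mkArcs R f))) = mkArcs R h ∧ Set.InjOn h R ∧
      (∀ p ∈ R, h p < p) ∧ R.image h = R.image f ∧
      arcCr2 (mkArcs R h) = arcPmaj (mkArcs R f) := by
  obtain ⟨g, hg⟩ := exists_phiProps (isMatch_splitFun hinj hlt)
  have hodd : ∀ y ∈ R, ∃ z ∈ R, g (2 * y) = 2 * f z + 1 := by
    intro y hy
    have : g (2 * y) ∈ (double R).image (splitFun f) :=
      hg.image_eq ▸ Finset.mem_image_of_mem g (two_mul_mem_double.2 hy)
    obtain ⟨p, hp, e⟩ := Finset.mem_image.1 this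
    obtain ⟨z, hz, rfl⟩ := mem_double.1 hp
    exact ⟨z, hz, by rw [← e, splitFun_two_mul]⟩
  obtain ⟨h, hh⟩ : ∃ h : ℕ → ℕ, h = fun y => g (2 * y) / 2 := ⟨_, rfl⟩
  have hgh : ∀ y ∈ R, g (2 * y) = 2 * h y + 1 := by
    intro y hy
    obtain ⟨z, -, e⟩ := hodd y hy
    rw [hh]; simp only; omega
  refine ⟨h, ?_, ?_, ?_, ?_, ?_, ?_⟩
  · rw [splitArcs_mkArcs, hg.eq]
    exact mkArcs_congr (forall_mem_double.2 fun y hy => by rw [hgh y hy, splitFun_two_mul])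
  · rw [splitArcs_mkArcs, hg.eq, mergeArcs_mkArcs hgh]
  · intro y hy z hz e
    have := hg.isMatch.inj (two_mul_mem_double.2 hy) (two_mul_mem_double.2 hz)
      (by rw [hgh y hy, hgh z hz, e])
    omega
  · intro y hy
    have := hg.isMatch.lt _ (two_mul_mem_double.2 hy)
    rw [hgh y hy] at this
    omega
  · ext x
    simp only [Finset.mem_image]
    constructor
    · rintro ⟨y, hy, rfl⟩
      obtain ⟨z, hz, e⟩ := hodd y hy
      exact ⟨z, hz, by have := hgh y hy; omega⟩
    · rintro ⟨y, hy, rfl⟩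
      have : splitFun f (2 * y) ∈ (double R).image g :=
        hg.image_eq ▸ Finset.mem_image_of_mem _ (two_mul_mem_double.2 hy)
      obtain ⟨p, hp, e⟩ := Finset.mem_image.1 this
      obtain ⟨z, hz, rfl⟩ := mem_double.1 hp
      rw [splitFun_two_mul, hgh z hz] at e
      exact ⟨z, hz, by omega⟩
  · rw [arcCr2_mkArcs, arcPmaj_mkArcs hlt, ← crossNum_double hgh, hg.cross,
      majNum_double hinj hlt]

/-! ### Partitions and their arcs -/

/-- Arc sets of partitions of `[n]`. -/
structure IsArcSet (n : ℕ) (A : Finset (ℕ × ℕ)) : Prop where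
  mem : ∀ e ∈ A, e.1 ∈ Finset.Icc 1 n ∧ e.2 ∈ Finset.Icc 1 n
  lt : ∀ e ∈ A, e.1 < e.2
  left : ∀ e ∈ A, ∀ e' ∈ A, e.1 = e'.1 → e = e'
  right : ∀ e ∈ A, ∀ e' ∈ A, e.2 = e'.2 → e = e'

/-- `x` and `y` are in the same block of `P`. -/
def SameBlock {n : ℕ} (P : Finpartition (Finset.Icc 1 n)) (x y : ℕ) : Prop :=
  ∃ B ∈ P.parts, x ∈ B ∧ y ∈ B

section Partitions

variable {n : ℕ} {P Q : Finpartition (Finset.Icc 1 n)} {x y z : ℕ}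

theorem SameBlock.symm (h : SameBlock P x y) : SameBlock P y x := by
  obtain ⟨B, hB, hx, hy⟩ := h
  exact ⟨B, hB, hy, hx⟩

theorem SameBlock.trans (h : SameBlock P x y) (h' : SameBlock P y z) : SameBlock P x z := by
  obtain ⟨B, hB, hx, hy⟩ := h
  obtain ⟨C, hC, hy', hz⟩ := h'
  obtain rfl := P.eq_of_mem_parts hB hC hy hy'
  exact ⟨B, hB, hx, hz⟩

theorem SameBlock.mem_left (h : SameBlock P x y) : x ∈ Finset.Icc 1 n := by
  obtain ⟨B, hB, hx, -⟩ := h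
  exact P.subset hB hx

theorem sameBlock_self (hx : x ∈ Finset.Icc 1 n) : SameBlock P x x := by
  obtain ⟨B, hB, h⟩ := P.exists_mem hx
  exact ⟨B, hB, h, h⟩

theorem SameBlock.mem_iff {B : Finset ℕ} (hB : B ∈ P.parts) (hx : x ∈ B) :
    SameBlock P x y ↔ y ∈ B := by
  refine ⟨fun ⟨C, hC, hx', hy⟩ => ?_, fun hy => ⟨B, hB, hx, hy⟩⟩
  rwa [P.eq_of_mem_parts hB hC hx hx']

theorem mem_arcs : (x, y) ∈ arcs P ↔
    x < y ∧ SameBlock P x y ∧ ∀ c, SameBlock P x c → ¬ (x < c ∧ c < y) := by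
  simp only [arcs, Finset.mem_filter, Finset.mem_product]
  constructor
  · rintro ⟨_, h1, B, hB, hx, hy, h2⟩
    exact ⟨h1, ⟨B, hB, hx, hy⟩, fun c hc => h2 c ((SameBlock.mem_iff hB hx).1 hc)⟩
  · rintro ⟨h1, h2, h3⟩
    refine ⟨⟨h2.mem_left, h2.symm.mem_left⟩, h1, ?_⟩
    obtain ⟨B, hB, hx, hy⟩ := h2
    exact ⟨B, hB, hx, hy, fun c hc => h3 c ((SameBlock.mem_iff hB hx).2 hc)⟩

theorem isArcSet_arcs (P : Finpartition (Finset.Icc 1 n)) : IsArcSet n (arcs P) where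
  mem e he := by
    obtain ⟨-, h, -⟩ := mem_arcs.1 he
    exact ⟨h.mem_left, h.symm.mem_left⟩
  lt e he := (mem_arcs.1 he).1
  left := by
    rintro ⟨x, y⟩ he ⟨x', y'⟩ he' h
    obtain rfl : x = x' := h
    obtain ⟨h1, h2, h3⟩ := mem_arcs.1 he
    obtain ⟨h1', h2', h3'⟩ := mem_arcs.1 he'
    have := h3 y' h2'
    have := h3' y h2
    exact Prod.ext rfl (show y = y' by omega)
  right := by
    rintro ⟨x, y⟩ he ⟨x', y'⟩ he' h
    obtain rfl : y = y' := h
    obtain ⟨h1, h2, h3⟩ := mem_arcs.1 he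
    obtain ⟨h1', h2', h3'⟩ := mem_arcs.1 he'
    have := h3 x' (h2.trans h2'.symm)
    have := h3' x (h2'.trans h2.symm)
    exact Prod.ext (show x = x' by omega) rfl

/-- An element that is not the last one of its block starts an arc. -/
theorem SameBlock.exists_arc_right (h : SameBlock P x y) (hxy : x < y) :
    ∃ z, (x, z) ∈ arcs P ∧ z ≤ y := by
  obtain ⟨B, hB, hx, hy⟩ := h
  have hne : (B.filter fun c => x < c).Nonempty := ⟨y, by simp [hy, hxy]⟩
  obtain ⟨z, hz⟩ := Finset.exists_minimal hne
  obtain ⟨hzB, hxz⟩ : z ∈ B ∧ x < z := by simpa using hz.1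
  have hmin : ∀ c ∈ B, x < c → z ≤ c := fun c hc h => not_lt.1 fun h' =>
    hz.not_lt (by simp [hc, h]) h'
  refine ⟨z, mem_arcs.2 ⟨hxz, ⟨B, hB, hx, hzB⟩, fun c hc h => ?_⟩, hmin y hy hxy⟩
  have := hmin c ((SameBlock.mem_iff hB hx).1 hc) h.1
  omega

/-- An element that is not the first one of its block ends an arc. -/
theorem SameBlock.exists_arc_left (h : SameBlock P x y) (hxy : x < y) :
    ∃ z, (z, y) ∈ arcs P := by
  obtain ⟨B, hB, hx, hy⟩ := h
  have hne : (B.filter fun c => c < y).Nonempty := ⟨x, by simp [hx, hxy]⟩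
  obtain ⟨z, hz⟩ := Finset.exists_maximal hne
  obtain ⟨hzB, hzy⟩ : z ∈ B ∧ z < y := by simpa using hz.1
  have hmax : ∀ c ∈ B, c < y → c ≤ z := fun c hc h => not_lt.1 fun h' =>
    hz.not_gt (by simp [hc, h]) h'
  refine ⟨z, mem_arcs.2 ⟨hzy, ⟨B, hB, hzB, hy⟩, fun c hc h => ?_⟩⟩
  have := hmax c ((SameBlock.mem_iff hB hzB).1 hc) h.2
  omega

/-- Walking along the arcs of a block leads from any element to any later one, by induction on the
distance. -/
theorem SameBlock.of_arcs_subset (h : arcs P ⊆ arcs Q) (hxy : SameBlock P x y) :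
    SameBlock Q x y := by
  have key : ∀ d x y, y = x + d → SameBlock P x y → SameBlock Q x y := by
    intro d
    induction d using Nat.strong_induction_on with
    | _ d ih =>
      intro x y hd hs
      rcases Nat.eq_zero_or_pos d with rfl | hpos
      · subst hd; exact sameBlock_self hs.mem_left
      · obtain ⟨z, hz, hzy⟩ := hs.exists_arc_right (by omega)
        obtain ⟨h1, h2, -⟩ := mem_arcs.1 hz
        have h3 := ih (y - z) (by omega) z y (by omega) (h2.symm.trans hs)
        exact (mem_arcs.1 (h hz)).2.1.trans h3
  rcases le_total x y with hle | hle
  · exact key (y - x) x y (by omega) hxy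
  · exact (key (x - y) y x (by omega) hxy.symm).symm

theorem arcs_injective (h : arcs P = arcs Q) : P = Q := by
  have key : ∀ {P Q : Finpartition (Finset.Icc 1 n)}, arcs P = arcs Q → P.parts ⊆ Q.parts := by
    intro P Q h B hB
    obtain ⟨x, hx⟩ := P.nonempty_of_mem_parts hB
    obtain ⟨C, hC, hxC⟩ := Q.exists_mem (P.subset hB hx)
    have : B = C := by
      ext y
      rw [← SameBlock.mem_iff hB hx, ← SameBlock.mem_iff hC hxC]
      exact ⟨.of_arcs_subset h.subset, .of_arcs_subset h.symm.subset⟩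
    rwa [this]
  exact Finpartition.ext ((key h).antisymm (key h.symm))

theorem minElems_eq (P : Finpartition (Finset.Icc 1 n)) :
    minElems P = Finset.Icc 1 n \ (arcs P).image Prod.snd := by
  rw [minElems, ← Finset.filter_notMem_eq_sdiff]
  refine Finset.filter_congr fun x hx => ?_
  constructor
  · rintro ⟨B, hB, hxB, h⟩ hmem
    obtain ⟨⟨w, x'⟩, he, rfl⟩ := Finset.mem_image.1 hmem
    obtain ⟨h1, h2, -⟩ := mem_arcs.1 he
    have := h w ((SameBlock.mem_iff hB hxB).1 h2.symm)
    simp only at this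
    omega
  · intro h
    obtain ⟨B, hB, hxB⟩ := P.exists_mem hx
    refine ⟨B, hB, hxB, fun y hy => ?_⟩
    by_contra hlt
    obtain ⟨z, hz⟩ := SameBlock.exists_arc_left ⟨B, hB, hy, hxB⟩ (not_le.1 hlt)
    exact h (Finset.mem_image.2 ⟨_, hz, rfl⟩)

theorem maxElems_eq (P : Finpartition (Finset.Icc 1 n)) :
    maxElems P = Finset.Icc 1 n \ (arcs P).image Prod.fst := by
  rw [maxElems, ← Finset.filter_notMem_eq_sdiff]
  refine Finset.filter_congr fun x hx => ?_
  constructor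
  · rintro ⟨B, hB, hxB, h⟩ hmem
    obtain ⟨⟨x', w⟩, he, rfl⟩ := Finset.mem_image.1 hmem
    obtain ⟨h1, h2, -⟩ := mem_arcs.1 he
    have := h w ((SameBlock.mem_iff hB hxB).1 h2)
    simp only at this
    omega
  · intro h
    obtain ⟨B, hB, hxB⟩ := P.exists_mem hx
    refine ⟨B, hB, hxB, fun y hy => ?_⟩
    by_contra hlt
    obtain ⟨z, hz, -⟩ := SameBlock.exists_arc_right ⟨B, hB, hxB, hy⟩ (not_le.1 hlt)
    exact h (Finset.mem_image.2 ⟨_, hz, rfl⟩)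

/-! ### The partition generated by an arc set. -/

theorem sameBlock_ofArcs {A : Finset (ℕ × ℕ)} : SameBlock (ofArcs n A) x y ↔
    x ∈ Finset.Icc 1 n ∧ y ∈ Finset.Icc 1 n ∧ Relation.EqvGen (fun a b => (a, b) ∈ A) x y := by
  classical
  simp only [SameBlock, ofArcs, Finpartition.ofSetSetoid_parts, Finset.mem_image]
  constructor
  · rintro ⟨_, ⟨a, ha, rfl⟩, hx, hy⟩
    rw [Finset.mem_filter] at hx hy
    exact ⟨hx.1, hy.1, (hx.2.symm).trans _ _ _ hy.2⟩
  · rintro ⟨hx, hy, h⟩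
    exact ⟨_, ⟨x, hx, rfl⟩, Finset.mem_filter.2 ⟨hx, .refl _⟩, Finset.mem_filter.2 ⟨hy, h⟩⟩

open Relation in
-- Each vertex starts at most one arc and ends at most one, so the components are directed paths and
-- any two connected vertices are comparable along the path.
theorem IsArcSet.reflTransGen_or {A : Finset (ℕ × ℕ)} (hA : IsArcSet n A)
    (h : EqvGen (fun a b => (a, b) ∈ A) x y) :
    ReflTransGen (fun a b => (a, b) ∈ A) x y ∨ ReflTransGen (fun a b => (a, b) ∈ A) y x := by
  induction h with
  | rel a b h => exact Or.inl (.single h)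
  | refl a => exact Or.inl .refl
  | symm a b _ ih => exact ih.symm
  | trans a b c _ _ ih ih' =>
    rcases ih with h | h <;> rcases ih' with h' | h'
    · exact Or.inl (h.trans h')
    · rw [← reflTransGen_swap] at h h'
      have hU : Relator.RightUnique (Function.swap fun a b => (a, b) ∈ A) := by
        intro u v w huv huw
        exact congrArg Prod.fst (hA.right _ huv _ huw rfl)
      rcases ReflTransGen.total_of_right_unique hU h h' with h2 | h2
      · exact Or.inr (reflTransGen_swap.1 h2)
      · exact Or.inl (reflTransGen_swap.1 h2)
    · have hU : Relator.RightUnique (fun a b => (a, b) ∈ A) := by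
        intro u v w huv huw
        exact congrArg Prod.snd (hA.left _ huv _ huw rfl)
      exact ReflTransGen.total_of_right_unique hU h h'
    · exact Or.inr (h'.trans h)

open Relation in
theorem IsArcSet.le_of_reflTransGen {A : Finset (ℕ × ℕ)} (hA : IsArcSet n A)
    (h : ReflTransGen (fun a b => (a, b) ∈ A) x y) : x ≤ y := by
  induction h with
  | refl => exact le_rfl
  | tail _ h ih => exact ih.trans (hA.lt _ h).le

theorem arcs_ofArcs {A : Finset (ℕ × ℕ)} (hA : IsArcSet n A) : arcs (ofArcs n A) = A := by
  ext ⟨x, y⟩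
  simp only [mem_arcs, sameBlock_ofArcs]
  constructor
  · rintro ⟨hxy, ⟨hx, hy, h⟩, hno⟩
    rcases hA.reflTransGen_or h with h | h
    · rcases h.cases_head with h | ⟨z, hxz, hzy⟩
      · omega
      · have h1 := hA.lt _ hxz
        have h2 := hA.le_of_reflTransGen hzy
        -- The path from `x` to `y` starts with an arc to some `z ≤ y` in the same block; as no
        -- block element lies in between, `z = y`.
        have h3 := hno z ⟨hx, (hA.mem _ hxz).2, .rel _ _ hxz⟩
        simp only at h1
        obtain rfl : z = y := by omega
        exact hxz
    · have := hA.le_of_reflTransGen h; omega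
  · intro h
    obtain ⟨hx, hy⟩ := hA.mem _ h
    refine ⟨hA.lt _ h, ⟨hx, hy, .rel _ _ h⟩, ?_⟩
    rintro c ⟨-, -, hc⟩ ⟨h1, h2⟩
    rcases hA.reflTransGen_or hc with h3 | h3
    · rcases h3.cases_head with h4 | ⟨z, hxz, hzc⟩
      · omega
      · have h5 := congrArg Prod.snd (hA.left _ h _ hxz rfl)
        have h6 := hA.le_of_reflTransGen hzc
        simp only at h5
        omega
    · have := hA.le_of_reflTransGen h3; omega

/-! ### The map on partitions -/

theorem IsArcSet.injOn_leftOf {A : Finset (ℕ × ℕ)} (hA : IsArcSet n A) :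
    Set.InjOn (leftOf A) (rightEnds A) := by
  have e := eq_mkArcs hA.right
  intro p hp q hq h
  have h1 : (leftOf A p, p) ∈ mkArcs (rightEnds A) (leftOf A) := pair_mem_mkArcs.2 ⟨hp, rfl⟩
  have h2 : (leftOf A q, q) ∈ mkArcs (rightEnds A) (leftOf A) := pair_mem_mkArcs.2 ⟨hq, rfl⟩
  rw [← e] at h1 h2
  exact congrArg Prod.snd (hA.left _ h1 _ h2 h)

theorem IsArcSet.leftOf_lt {A : Finset (ℕ × ℕ)} (hA : IsArcSet n A) :
    ∀ p ∈ rightEnds A, leftOf A p < p := by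
  intro p hp
  have h1 : (leftOf A p, p) ∈ mkArcs (rightEnds A) (leftOf A) := pair_mem_mkArcs.2 ⟨hp, rfl⟩
  rw [← eq_mkArcs hA.right] at h1
  exact hA.lt _ h1

/-- What the algorithm does to the arcs of a partition. -/
theorem foataArcs_props (P : Finpartition (Finset.Icc 1 n)) :
    ∃ h, phi (splitArcs (arcs P)) = mkArcs (double (rightEnds (arcs P))) (splitFun h) ∧
      foataArcs P = mkArcs (rightEnds (arcs P)) h ∧ IsArcSet n (foataArcs P) ∧
      (foataArcs P).image Prod.fst = (arcs P).image Prod.fst ∧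
      (foataArcs P).image Prod.snd = (arcs P).image Prod.snd ∧
      arcCr2 (foataArcs P) = pmaj P := by
  have hA := isArcSet_arcs P
  have e := eq_mkArcs hA.right
  obtain ⟨h, h1, h2, h3, h4, h5, h6⟩ := exists_mergeArcs_phi hA.injOn_leftOf hA.leftOf_lt
  rw [← e] at h1 h2 h6
  have h2' : foataArcs P = mkArcs (rightEnds (arcs P)) h := h2
  have hfst : ∀ f : ℕ → ℕ, (mkArcs (rightEnds (arcs P)) f).image Prod.fst =
      (rightEnds (arcs P)).image f := fun f => by
    simp [mkArcs, Finset.image_image, Function.comp_def]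
  have hl : (foataArcs P).image Prod.fst = (arcs P).image Prod.fst := by
    rw [h2', hfst, h5, ← hfst, ← e]
  have hr : (foataArcs P).image Prod.snd = (arcs P).image Prod.snd := by
    rw [h2']
    exact rightEnds_mkArcs
  refine ⟨h, h1, h2', ⟨?_, ?_, ?_, ?_⟩, hl, hr, by rw [h2', h6]; rfl⟩
  · intro a ha
    constructor
    · have : a.1 ∈ (arcs P).image Prod.fst := hl ▸ Finset.mem_image_of_mem _ ha
      obtain ⟨a', ha', e'⟩ := Finset.mem_image.1 this
      exact e' ▸ (hA.mem a' ha').1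
    · have : a.2 ∈ (arcs P).image Prod.snd := hr ▸ Finset.mem_image_of_mem _ ha
      obtain ⟨a', ha', e'⟩ := Finset.mem_image.1 this
      exact e' ▸ (hA.mem a' ha').2
  · intro a ha
    rw [h2', mem_mkArcs] at ha
    rw [ha.2]
    exact h4 _ ha.1
  · intro a ha a' ha' hne
    rw [h2', mem_mkArcs] at ha ha'
    have := h3 ha.1 ha'.1 (by rw [← ha.2, ← ha'.2, hne])
    exact Prod.ext hne this
  · intro a ha a' ha' hne
    rw [h2', mem_mkArcs] at ha ha'
    exact Prod.ext (by rw [ha.2, ha'.2, hne]) hne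

theorem arcs_foataMap (P : Finpartition (Finset.Icc 1 n)) : arcs (foataMap P) = foataArcs P := by
  obtain ⟨_, _, _, h, _⟩ := foataArcs_props P
  exact arcs_ofArcs h

theorem pmaj_eq_Cr2_foataMap (P : Finpartition (Finset.Icc 1 n)) : pmaj P = Cr2 (foataMap P) := by
  obtain ⟨_, _, _, _, _, _, h⟩ := foataArcs_props P
  rw [Cr2, arcs_foataMap, h]

theorem foataMap_mem_partitionsWith {S T : Finset ℕ} (hP : P ∈ partitionsWith n S T) :
    foataMap P ∈ partitionsWith n S T := by
  obtain ⟨_, _, _, _, h1, h2, _⟩ := foataArcs_props P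
  simp only [partitionsWith, Finset.mem_filter, Finset.mem_univ, true_and, minElems_eq, maxElems_eq,
    arcs_foataMap, h1, h2] at hP ⊢
  exact hP

/-- Merging loses nothing: all right-hand copies are even and all left-hand copies odd, so the
merged arcs determine the value of `phi`, which in turn determines the arcs of the partition. -/
theorem foataMap_injective (n : ℕ) :
    Function.Injective (foataMap : Finpartition (Finset.Icc 1 n) → _) := by
  intro P Q hPQ
  have hA : foataArcs P = foataArcs Q := by rw [← arcs_foataMap, hPQ, arcs_foataMap]
  obtain ⟨h, h1, h2, -⟩ := foataArcs_props P
  obtain ⟨h', h1', h2', -⟩ := foataArcs_props Q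
  have hR : rightEnds (arcs P) = rightEnds (arcs Q) := by
    have := congrArg rightEnds hA
    rwa [h2, h2', rightEnds_mkArcs, rightEnds_mkArcs] at this
  rw [h2, h2', ← hR, mkArcs_inj] at hA
  have hphi : phi (splitArcs (arcs P)) = phi (splitArcs (arcs Q)) := by
    rw [h1, h1', ← hR]
    exact mkArcs_congr (forall_mem_double.2 fun y hy => by
      rw [splitFun_two_mul, splitFun_two_mul, hA hy])
  have hP := isArcSet_arcs P
  have hQ := isArcSet_arcs Q
  have hQi := hQ.injOn_leftOf
  have hQl := hQ.leftOf_lt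
  have eP := eq_mkArcs hP.right
  have eQ := eq_mkArcs hQ.right
  rw [← hR] at eQ hQi hQl
  refine arcs_injective ?_
  rw [eP, eQ]
  refine mkArcs_congr fun y hy => ?_
  have e : phi (mkArcs (double (rightEnds (arcs P))) (splitFun (leftOf (arcs P)))) =
      phi (mkArcs (double (rightEnds (arcs P))) (splitFun (leftOf (arcs Q)))) := by
    rw [← splitArcs_mkArcs, ← splitArcs_mkArcs, ← eP, ← eQ, hphi]
  have := phi_injective (isMatch_splitFun hP.injOn_leftOf hP.leftOf_lt) (isMatch_splitFun hQi hQl) e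
    (two_mul_mem_double.2 hy)
  rw [splitFun_two_mul, splitFun_two_mul] at this
  omega

end Partitions

end MatchingFoata

theorem mainTheorem4 (n : ℕ) (S T : Finset ℕ) (hS : S ⊆ Finset.Icc 1 n)
    (hT : T ⊆ Finset.Icc 1 n) (hST : S.card = T.card) :
    -- `φ` is well defined: the arcs produced by the algorithm are exactly the arcs of `φ(M)`
    (∀ M ∈ MatchingFoata.partitionsWith n S T,
      MatchingFoata.arcs (MatchingFoata.foataMap M) = MatchingFoata.foataArcs M) ∧
    -- `φ` is a bijection from `P_n(S, T)` to itself
    Set.BijOn MatchingFoata.foataMap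
      (MatchingFoata.partitionsWith n S T : Set (Finpartition (Finset.Icc 1 n)))
      (MatchingFoata.partitionsWith n S T) ∧
    -- `φ` carries the p-major index to the number of 2-crossings
    (∀ M ∈ MatchingFoata.partitionsWith n S T,
      MatchingFoata.pmaj M = MatchingFoata.Cr2 (MatchingFoata.foataMap M)) ∧
    -- hence the two statistics are equidistributed on `P_n(S, T)`
    (∀ k : ℕ,
      ((MatchingFoata.partitionsWith n S T).filter fun M => MatchingFoata.pmaj M = k).card =
      ((MatchingFoata.partitionsWith n S T).filter fun M => MatchingFoata.Cr2 M = k).card) := by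
  have hmaps : Set.MapsTo MatchingFoata.foataMap
      (MatchingFoata.partitionsWith n S T : Set (Finpartition (Finset.Icc 1 n)))
      (MatchingFoata.partitionsWith n S T) := fun M hM =>
    MatchingFoata.foataMap_mem_partitionsWith hM
  have hinj := (MatchingFoata.foataMap_injective n).injOn
    (s := (MatchingFoata.partitionsWith n S T : Set (Finpartition (Finset.Icc 1 n))))
  -- An injective map of a finite set into itself is onto, so no inverse algorithm has to be
  -- constructed.
  have hsurj := Finset.surjOn_of_injOn_of_card_le _ hmaps hinj le_rfl
  refine ⟨fun M _ => MatchingFoata.arcs_foataMap M, ⟨hmaps, hinj, hsurj⟩,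
    fun M _ => MatchingFoata.pmaj_eq_Cr2_foataMap M, fun k => ?_⟩
  refine Finset.card_bij (fun M _ => MatchingFoata.foataMap M) (fun M hM => ?_)
    (fun M _ M' _ h => MatchingFoata.foataMap_injective n h) (fun M hM => ?_)
  · rw [Finset.mem_filter] at hM ⊢
    exact ⟨hmaps hM.1, by rw [← MatchingFoata.pmaj_eq_Cr2_foataMap, hM.2]⟩
  · rw [Finset.mem_filter] at hM
    obtain ⟨M', hM', rfl⟩ := hsurj hM.1
    exact ⟨M', Finset.mem_filter.2 ⟨hM', by rw [MatchingFoata.pmaj_eq_Cr2_foataMap, hM.2]⟩, rfl⟩
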